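/- Let $q=2^e$ with $q\equiv 8\pmod{10}$, and put $n=\frac{q^2+1}{5}$, $r=q+1$, $s=\frac{q^2-q}{2}$. Let $\alpha\in\mathbb F_{q^2}$ be a primitive $r$-th root of unity and let $\delta$ be a primitive $rn$-th root of unity in an extension field of $\mathbb F_{q^2}$ with $\delta^n=\alpha$. For an $\alpha$-constacyclic code $\mathcal C\subseteq\mathbb F_{q^2}^n$ with monic generator polynomial $g\mid x^n-\alpha$, the defining set is $\{i\in\{1+rj: 0\le j\le n-1\} : g(\delta^i)=0\}$, read modulo $rn$; let $C_i=\{iq^{2j} \bmod rn : j\in\mathbb Z\}$ be the $q^2$-cyclotomic coset of $i$ modulo $rn$. Let $\lambda$ be an integer with $1\le\lambda\le\frac{q+2}{5}$. Then there is an $\alpha$-constacyclic code of length $n$ over $\mathbb F_{q^2}$ with defining set $$Z=\bigcup_{j=0}^{\frac{3q-14}{10}+\lambda} C_{s-rj}.$$ For each such code $\mathcal C$, put $$k=n-\tfrac25(3q-14)-4\lambda,\qquad d=\tfrac{3q-14}{5}+2\lambda+3 .$$ Then $\mathcal C$ has minimum distance $d$, every parity check matrix $H$ of $\mathcal C$ satisfies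 $\operatorname{rank}(HH^*)=4$, where $H^*$ is the transpose of $H$ with entries raised to the power $q$, and $k=2\dim\mathcal C-n+4$. Moreover there exists an entanglement-assisted quantum error-correcting code with parameters $$[[\,n,\;k,\;d;\;4\,]]_q ,$$ that is, a code that encodes $k$ qudits of dimension $q$ into $n$ such qudits with the help of $4$ maximally entangled pairs shared in advance, and whose minimum distance with respect to errors on the $n$ transmitted qudits is exactly $d$. It is an EAQMDS code, i.e. it attains the entanglement-assisted Singleton bound: $n+4-k=2(d-1)$; and $d\le\frac{n+2}{2}$ holds except in the single case $q=8$, $\lambda=2$ (parameters $[[13,1,9;4]]_8$). -/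

import Mathlib

open scoped Kronecker Polynomial

namespace EAQ

/-! ### Constacyclic codes over `F`, where `F` is the field with `q ^ 2` elements -/

section Classical

variable {F : Type*} [Field F]

/-- The polynomial `c₀ + c₁ x + ⋯ + c_{n-1} x ^ (n-1)` of a word. -/
noncomputable def wordPoly {n : ℕ} (c : Fin n → F) : F[X] :=
  ∑ i : Fin n, Polynomial.C (c i) * Polynomial.X ^ (i : ℕ)

/-- The constacyclic shift `(α c_{n-1}, c₀, …, c_{n-2})` of a word. -/
def constacyclicShift (α : F) {n : ℕ} (c : Fin n → F) : Fin n → F := fun i =>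
  if (i : ℕ) = 0 then α * c ⟨n - 1, by have := i.isLt; omega⟩
  else c ⟨i - 1, by have := i.isLt; omega⟩

/-- A linear code is `α`-constacyclic if it is closed under the constacyclic shift. -/
def IsConstacyclic (α : F) {n : ℕ} (C : Submodule F (Fin n → F)) : Prop :=
  ∀ c ∈ C, constacyclicShift α c ∈ C

/-- `g` is the monic generator polynomial of the code: `g` divides `x ^ n - α` and the codewords
are the words whose class modulo `x ^ n - α` lies in the ideal generated by `g`. -/
def IsGeneratorPoly (α : F) {n : ℕ} (C : Submodule F (Fin n → F)) (g : F[X]) : Prop :=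
  g.Monic ∧ g ∣ Polynomial.X ^ n - Polynomial.C α ∧ ∀ c : Fin n → F, c ∈ C ↔ g ∣ wordPoly c

/-- `𝒪_{rn} = {1 + r j | 0 ≤ j ≤ n - 1}`, as residues modulo `r n`. -/
def exponentSet (r n : ℕ) : Set (ZMod (r * n)) :=
  {i | ∃ j : ℕ, j < n ∧ i = ((1 + r * j : ℕ) : ZMod (r * n))}

/-- `Z` is the defining set of the `α`-constacyclic code `C = ⟨g⟩` with respect to `δ`, a primitive
`r n`-th root of unity in an extension field: the set of `i ∈ 𝒪_{rn}` with `g (δ ^ i) = 0`. -/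
def HasDefiningSet {K : Type*} [Field K] [Algebra F K] (α : F) (δ : K) (r : ℕ) {n : ℕ}
    (C : Submodule F (Fin n → F)) (Z : Set (ZMod (r * n))) : Prop :=
  ∃ g : F[X], IsGeneratorPoly α C g ∧
    Z = {i | i ∈ exponentSet r n ∧ Polynomial.aeval (δ ^ i.val) g = 0}

/-- The `Q`-cyclotomic coset of `i` modulo `N` (for `Q` coprime to `N`, nonnegative exponents
already give the whole orbit). -/
def cyclotomicCoset (Q N : ℕ) (i : ℤ) : Set (ZMod N) :=
  {x | ∃ j : ℕ, x = (i : ZMod N) * (Q : ZMod N) ^ j}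

/-- The union of the `q ^ 2`-cyclotomic cosets of `s - r j` modulo `r n`, for `0 ≤ j ≤ J`. -/
def cosetUnion (q r n : ℕ) (s : ℤ) (J : ℕ) : Set (ZMod (r * n)) :=
  ⋃ j ∈ Set.Icc 0 J, cyclotomicCoset (q ^ 2) (r * n) (s - r * j)

/-- `d` is the minimum weight of the nonzero codewords of `C`. -/
def IsMinWeight [DecidableEq F] {n : ℕ} (C : Submodule F (Fin n → F)) (d : ℕ) : Prop :=
  IsLeast {w : ℕ | ∃ c ∈ C, c ≠ 0 ∧ hammingNorm c = w} d

/-- `H` is a parity check matrix of `C`: its rows are linearly independent and `C` is the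
kernel of `H`. -/
def IsParityCheck {n m : ℕ} (C : Submodule F (Fin n → F)) (H : Matrix (Fin m) (Fin n) F) : Prop :=
  LinearIndependent F H.row ∧ ∀ c : Fin n → F, c ∈ C ↔ H.mulVec c = 0

/-- The conjugate transpose `H^*` over the field with `q ^ 2` elements; conjugation is
`x ↦ x ^ q`. -/
def hermTranspose (q : ℕ) {m n : ℕ} (H : Matrix (Fin m) (Fin n) F) : Matrix (Fin n) (Fin m) F :=
  fun i j => H j i ^ q

end Classical

/-! ### Entanglement-assisted quantum codes

The standard basis of `m` qudits of dimension `q`, that is of `(ℂ^q)^{⊗ m}`, is indexed by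
`Fin m → Fin q`; operators are matrices in these bases. -/

section Quantum

/-- An encoder of `k` qudits into `n` qudits with the help of `c` maximally entangled pairs of
qudits: an isometry from the sender's `k` message qudits and her `c` halves of the pairs to the `n`
qudits that are sent through the channel. The receiver holds the other `c` halves. -/
structure EAEncoder (q n k c : ℕ) where
  V : Matrix (Fin n → Fin q) ((Fin k → Fin q) × (Fin c → Fin q)) ℂ
  isometry : V.conjTranspose * V = 1

namespace EAEncoder

variable {q n k c : ℕ}

/-- The encoding as seen by the receiver, on the `n` channel qudits and his `c` noiseless qudits:
`|m⟩ ↦ (V ⊗ 1) (|m⟩ ⊗ |Φ⟩)`, where `|Φ⟩ = q ^ (-c/2) ∑_b |b⟩ ⊗ |b⟩`. -/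
noncomputable def encoding (𝒬 : EAEncoder q n k c) :
    Matrix ((Fin n → Fin q) × (Fin c → Fin q)) (Fin k → Fin q) ℂ :=
  fun x m => 𝒬.V x.1 (m, x.2) / ((Real.sqrt ((q : ℝ) ^ c) : ℝ) : ℂ)

/-- The operator `E` on `n` qudits acts only on the qudits in `T`: it is `M ⊗ 1` for an operator
`M` on the qudits in `T`. -/
def ActsOn (T : Finset (Fin n)) (E : Matrix (Fin n → Fin q) (Fin n → Fin q) ℂ) : Prop :=
  ∃ M : Matrix (T → Fin q) (T → Fin q) ℂ, ∀ x y : Fin n → Fin q,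
    ((∀ i, i ∉ T → x i = y i) → E x y = M (fun i => x i) (fun i => y i)) ∧
    ((¬ ∀ i, i ∉ T → x i = y i) → E x y = 0)

/-- The code detects the error `E` on the channel qudits (Knill–Laflamme condition): with `P` the
projection onto the code space, `P (E ⊗ 1) P` is a multiple of `P`. It is written here with the
isometry `W = encoding`, for which `P = W W^*`. -/
def Detects (𝒬 : EAEncoder q n k c) (E : Matrix (Fin n → Fin q) (Fin n → Fin q) ℂ) : Prop :=
  ∃ z : ℂ, 𝒬.encoding.conjTranspose *
    (E ⊗ₖ (1 : Matrix (Fin c → Fin q) (Fin c → Fin q) ℂ)) * 𝒬.encoding = z • 1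

/-- The minimum distance is `d`: all errors on fewer than `d` of the channel qudits are detected,
and some error on `d` of them is not. -/
def HasMinDistance (𝒬 : EAEncoder q n k c) (d : ℕ) : Prop :=
  IsLeast {w : ℕ | ∃ T : Finset (Fin n), T.card = w ∧
    ∃ E : Matrix (Fin n → Fin q) (Fin n → Fin q) ℂ, ActsOn T E ∧ ¬ 𝒬.Detects E} d

end EAEncoder

/-- An entanglement-assisted quantum code with parameters `[[n, k, d; c]]_q` exists. -/
def ExistsEAQEC (q n k d c : ℕ) : Prop :=
  ∃ 𝒬 : EAEncoder q n k c, 𝒬.HasMinDistance d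

end Quantum

end EAQ

/-! Write `q = 10a + 8`, so that `n = 20a² + 32a + 13` and `s = (5a + 4)(10a + 7)`. Since `s ≡ 1`
modulo `r`, the roots of `xⁿ - α` are the `δ ^ (s + r t)` with `t` modulo `n`. Since `q² ≡ -1` and
`s (q - 1) ≡ 1` modulo `n`, raising to the power `q²` acts on them by `t ↦ 1 - t`. With `J = (3q -
14)/10 + λ` the set `Z` is therefore the block `-J ≤ t ≤ J + 1` of `2J + 2` consecutive exponents.
It is Frobenius-stable, so the code exists; its dimension is `n - 2J - 2`, and the BCH bound makes
it MDS with distance `2J + 3`.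

Let `Y` be the set of roots of `C`. The Hermitian dual `D` has as roots the `ρ` with `ρ ^ (-q) ∉ Y`,
and `rank (H H*) = dim D - dim (C ∩ D)` is the number of `ρ ∈ Y` with `ρ ^ (-q) ∈ Y`. In exponents
this condition is `n ∣ s + q t + t'`, which `mem_of_dvd_add` shows to have exactly four admissible
`t`.

For the quantum code, a qudit of dimension `q = 2 ^ e` carries an error basis labelled by `F` with
its symplectic form `Tr (x y ^ q)`, and `C`, `D` become symplectic complements of each other.
Hyperbolic pairs of `D` modulo `C ∩ D` play the role of the shared pairs, those of `C` modulo `C ∩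
D` are the logical operators, and a joint eigenvector of a maximal isotropic part generates the
code. Averaged over the receiver's half, an error outside `C` has zero matrix elements, whereas one
in `C \ D` acts as a nontrivial logical operator (`existsEAQEC_of_orthogonal`). The distance is thus
the minimum weight of `C` once that weight is attained outside `D`. It is, because minimum weight
words of an MDS code span it and `C ⊄ D`, as `n > 4J`. -/

namespace EAQ

/-! ### Symplectic Gram–Schmidt: hyperbolic pairs in a space with an alternating form. -/

section Hyperbolic

variable {k V : Type*} [Field k] [AddCommGroup V] [Module k V]

/-- A family of hyperbolic pairs `(x i, z i)` for an alternating form. -/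
structure IsHyperbolic {ι : Type*} [DecidableEq ι] (B : LinearMap.BilinForm k V) (x z : ι → V) :
    Prop where
  xx : ∀ i j, B (x i) (x j) = 0
  zz : ∀ i j, B (z i) (z j) = 0
  xz : ∀ i j, B (x i) (z j) = if i = j then 1 else 0

namespace IsHyperbolic

variable {ι : Type*} {B : LinearMap.BilinForm k V} {x z : ι → V}

section Projection

variable [Fintype ι]

/-- The projection to the orthogonal complement of the span of a hyperbolic family. -/
def proj (B : LinearMap.BilinForm k V) (x z : ι → V) (w : V) : V :=
  w - ∑ i, B w (z i) • x i + ∑ i, B w (x i) • z i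

theorem apply_proj (w w' : V) (hx : ∀ i, B (x i) w = 0) (hz : ∀ i, B (z i) w = 0)
    (hB : B.IsAlt) : B w (proj B x z w') = B w w' := by
  have hx' : ∀ i, B w (x i) = 0 := fun i => by rw [← hB.neg_eq, hx, neg_zero]
  have hz' : ∀ i, B w (z i) = 0 := fun i => by rw [← hB.neg_eq, hz, neg_zero]
  simp [proj, hx', hz']

theorem proj_mem (W : Submodule k V) (hx : ∀ i, x i ∈ W) (hz : ∀ i, z i ∈ W) {w : V}
    (hw : w ∈ W) : proj B x z w ∈ W :=
  W.add_mem (W.sub_mem hw (W.sum_mem fun i _ => W.smul_mem _ (hx i)))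
    (W.sum_mem fun i _ => W.smul_mem _ (hz i))

end Projection

variable [DecidableEq ι]

theorem zx (h : IsHyperbolic B x z) (hB : B.IsAlt) (i j : ι) :
    B (z i) (x j) = if i = j then -1 else 0 := by
  rw [← hB.neg_eq (x j) (z i), h.xz]
  by_cases hij : i = j <;> simp [hij, eq_comm]

variable [Fintype ι]

theorem apply_sum_x (h : IsHyperbolic B x z) (j : ι) (a : ι → k) :
    B (x j) (∑ i, a i • x i) = 0 := by
  simp [h.xx]

theorem apply_sum_z (h : IsHyperbolic B x z) (j : ι) (a : ι → k) :
    B (x j) (∑ i, a i • z i) = a j := by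
  simp [h.xz]

theorem apply_sum_x' (h : IsHyperbolic B x z) (hB : B.IsAlt) (j : ι) (a : ι → k) :
    B (z j) (∑ i, a i • x i) = -a j := by
  simp [h.zx hB]

theorem apply_sum_z' (h : IsHyperbolic B x z) (j : ι) (a : ι → k) :
    B (z j) (∑ i, a i • z i) = 0 := by
  simp [h.zz]

theorem apply_x_proj (h : IsHyperbolic B x z) (hB : B.IsAlt) (j : ι) (w : V) :
    B (x j) (proj B x z w) = 0 := by
  rw [proj, map_add, map_sub, h.apply_sum_x, h.apply_sum_z, ← hB.neg_eq]
  ring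

theorem apply_z_proj (h : IsHyperbolic B x z) (hB : B.IsAlt) (j : ι) (w : V) :
    B (z j) (proj B x z w) = 0 := by
  rw [proj, map_add, map_sub, h.apply_sum_x' hB, h.apply_sum_z', ← hB.neg_eq]
  ring

theorem linearIndependent_x (h : IsHyperbolic B x z) (hB : B.IsAlt) : LinearIndependent k x := by
  rw [Fintype.linearIndependent_iff]
  intro a ha j
  have := h.apply_sum_x' hB j a
  rw [ha, map_zero] at this
  simpa using this.symm

/-- Pairing with the family maps `W` onto `k ^ (2m)`, and by `hrad` the kernel is the radical of
`W`. -/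
theorem finrank_eq [FiniteDimensional k V] {m : ℕ} {x z : Fin m → V} (h : IsHyperbolic B x z)
    (hB : B.IsAlt) (W : Submodule k V) (hx : ∀ i, x i ∈ W) (hz : ∀ i, z i ∈ W)
    (hrad : ∀ w ∈ W, (∀ i, B (x i) w = 0) → (∀ i, B (z i) w = 0) → ∀ w' ∈ W, B w w' = 0) :
    Module.finrank k W = Module.finrank k (W ⊓ B.orthogonal W : Submodule k V) + 2 * m := by
  let f : V →ₗ[k] (Fin m → k) × (Fin m → k) :=
    (LinearMap.pi fun i => B (x i)).prod (LinearMap.pi fun i => B (z i))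
  let g := f.domRestrict W
  have hsurj : LinearMap.range g = ⊤ := by
    rw [LinearMap.range_eq_top]
    rintro ⟨a, b⟩
    refine ⟨⟨∑ i, a i • z i + ∑ i, (-b i) • x i, W.add_mem
      (W.sum_mem fun i _ => W.smul_mem _ (hz i)) (W.sum_mem fun i _ => W.smul_mem _ (hx i))⟩, ?_⟩
    refine Prod.ext (funext fun j => ?_) (funext fun j => ?_)
    · change B (x j) (∑ i, a i • z i + ∑ i, (-b i) • x i) = a j
      rw [map_add, h.apply_sum_z, h.apply_sum_x, add_zero]
    · change B (z j) (∑ i, a i • z i + ∑ i, (-b i) • x i) = b j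
      rw [map_add, h.apply_sum_z', h.apply_sum_x' hB, zero_add, neg_neg]
  have hker : (LinearMap.ker g).map W.subtype = W ⊓ B.orthogonal W := by
    ext w
    simp only [Submodule.mem_map, Submodule.mem_inf, LinearMap.mem_ker]
    constructor
    · rintro ⟨⟨w, hw⟩, hgw, rfl⟩
      refine ⟨hw, fun w' hw' => ?_⟩
      have h1 : ∀ i, B (x i) w = 0 := fun i => congrFun (congrArg Prod.fst hgw) i
      have h2 : ∀ i, B (z i) w = 0 := fun i => congrFun (congrArg Prod.snd hgw) i
      change B w' w = 0
      rw [← hB.neg_eq, hrad w hw h1 h2 w' hw', neg_zero]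
    · rintro ⟨hw, hw'⟩
      exact ⟨⟨w, hw⟩, Prod.ext (funext fun i => hw' _ (hx i)) (funext fun i => hw' _ (hz i)), rfl⟩
  have h1 := LinearMap.finrank_range_add_finrank_ker g
  rw [hsurj, finrank_top, Module.finrank_prod, Module.finrank_fin_fun] at h1
  rw [← hker, Submodule.finrank_map_subtype_eq]
  omega

end IsHyperbolic

/-- A hyperbolic family in `W` of maximal size works: if `w` is orthogonal to it but `B w w' ≠ 0`,
then `w` and the rescaled projection of `w'` form one more pair. -/
theorem exists_isHyperbolic [FiniteDimensional k V] (B : LinearMap.BilinForm k V) (hB : B.IsAlt)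
    (W : Submodule k V) : ∃ m, ∃ x z : Fin m → V, (∀ i, x i ∈ W) ∧ (∀ i, z i ∈ W) ∧
      IsHyperbolic B x z ∧
      ∀ w ∈ W, (∀ i, B (x i) w = 0) → (∀ i, B (z i) w = 0) → ∀ w' ∈ W, B w w' = 0 := by
  let S : ℕ → Prop := fun m => ∃ x z : Fin m → V, (∀ i, x i ∈ W) ∧ (∀ i, z i ∈ W) ∧
    IsHyperbolic B x z
  have hbound : ∀ m, S m → m ≤ Module.finrank k V := by
    rintro m ⟨x, z, -, -, h⟩
    simpa using (h.linearIndependent_x hB).fintype_card_le_finrank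
  have h0 : S 0 := ⟨Fin.elim0, Fin.elim0, fun i => i.elim0, fun i => i.elim0,
    ⟨fun i => i.elim0, fun i => i.elim0, fun i => i.elim0⟩⟩
  classical
  set m := Nat.findGreatest S (Module.finrank k V) with hm
  obtain ⟨x, z, hx, hz, h⟩ : S m := Nat.findGreatest_spec (P := S) (Nat.zero_le _) h0
  refine ⟨m, x, z, hx, hz, h, fun w hw hwx hwz w' hw' => ?_⟩
  by_contra hne
  suffices S (m + 1) by
    have := Nat.le_findGreatest (hbound _ this) this
    omega
  set v := (B w w')⁻¹ • IsHyperbolic.proj B x z w' with hv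
  have hwv : B w v = 1 := by
    rw [hv, map_smul, IsHyperbolic.apply_proj w w' hwx hwz hB, smul_eq_mul, inv_mul_cancel₀ hne]
  have hvx : ∀ i, B (x i) v = 0 := fun i => by rw [hv, map_smul, h.apply_x_proj hB, smul_zero]
  have hvz : ∀ i, B (z i) v = 0 := fun i => by rw [hv, map_smul, h.apply_z_proj hB, smul_zero]
  have hwx' : ∀ i, B w (x i) = 0 := fun i => by rw [← hB.neg_eq, hwx, neg_zero]
  have hwz' : ∀ i, B w (z i) = 0 := fun i => by rw [← hB.neg_eq, hwz, neg_zero]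
  have hvz' : ∀ i, B v (z i) = 0 := fun i => by rw [← hB.neg_eq, hvz, neg_zero]
  have hvW : v ∈ W := W.smul_mem _ (IsHyperbolic.proj_mem W hx hz hw')
  refine ⟨Fin.cons w x, Fin.cons v z, Fin.cases hw hx, Fin.cases hvW hz, ⟨?_, ?_, ?_⟩⟩
  · refine Fin.cases (Fin.cases (hB w) hwx') fun i => Fin.cases (hwx i) (h.xx i)
  · refine Fin.cases (Fin.cases (hB v) hvz') fun i => Fin.cases (hvz i) (h.zz i)
  · refine Fin.cases (Fin.cases ?_ ?_) fun i => Fin.cases ?_ ?_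
    · simpa using hwv
    · intro j
      simpa [Fin.succ_ne_zero, eq_comm] using hwz' j
    · simpa using hvx i
    · intro j
      simpa using h.xz i j

end Hyperbolic

/-! ### Nice error bases: Pauli matrices, tensor products, common eigenvectors. -/

section ErrorBasis

open Matrix

/-- The nontrivial character of `ZMod 2`. -/
def sgn (a : ZMod 2) : ℂ := if a = 0 then 1 else -1

theorem zmod_two_eq_one {a : ZMod 2} (h : a ≠ 0) : a = 1 := by
  revert a; decide

@[simp] theorem sgn_zero : sgn 0 = 1 := if_pos rfl

@[simp] theorem sgn_one : sgn 1 = -1 := if_neg one_ne_zero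

theorem sgn_of_ne_zero {a : ZMod 2} (h : a ≠ 0) : sgn a = -1 := if_neg h

theorem sgn_add (a b : ZMod 2) : sgn (a + b) = sgn a * sgn b := by
  by_cases ha : a = 0
  · simp [ha]
  by_cases hb : b = 0
  · simp [hb]
  have : (1 + 1 : ZMod 2) = 0 := by decide
  rw [zmod_two_eq_one ha, zmod_two_eq_one hb, this]
  simp

theorem sgn_mul_self (a : ZMod 2) : sgn a * sgn a = 1 := by
  rw [← sgn_add, CharTwo.add_self_eq_zero, sgn_zero]

theorem sgn_ne_zero (a : ZMod 2) : sgn a ≠ 0 := fun h => by simpa [h] using sgn_mul_self a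

@[simp] theorem star_sgn (a : ZMod 2) : star (sgn a) = sgn a := by
  unfold sgn
  split_ifs <;> simp

theorem sgn_sum {ι : Type*} (s : Finset ι) (f : ι → ZMod 2) :
    sgn (∑ i ∈ s, f i) = ∏ i ∈ s, sgn (f i) := by
  classical
  induction s using Finset.induction_on with
  | empty => simp
  | insert a s ha ih => rw [Finset.sum_insert ha, Finset.prod_insert ha, sgn_add, ih]

/-- A nice error basis: a projective representation by unitary matrices of a vector space over
`ZMod 2`, with commutation relations given by `ω`, in which only the identity has a trace. -/
structure IsErrorBasis {V I : Type*} [AddCommGroup V] [Module (ZMod 2) V] [Fintype I]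
    [DecidableEq I] (ω : LinearMap.BilinForm (ZMod 2) V) (P : V → Matrix I I ℂ) : Prop where
  zero : P 0 = 1
  mul : ∀ u v, ∃ c : ZMod 2, P u * P v = sgn c • P (u + v)
  unitary : ∀ u, (P u)ᴴ * P u = 1
  comm : ∀ u v, P u * P v = sgn (ω u v) • (P v * P u)
  trace : ∀ u, u ≠ 0 → (P u).trace = 0

/-- The symplectic form of one qubit. -/
def qubitForm : LinearMap.BilinForm (ZMod 2) (ZMod 2 × ZMod 2) :=
  LinearMap.mk₂ (ZMod 2) (fun u v => u.1 * v.2 + u.2 * v.1)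
    (fun _ _ _ => by simp only [Prod.fst_add, Prod.snd_add]; ring)
    (fun _ _ _ => by simp only [Prod.smul_fst, Prod.smul_snd, smul_eq_mul]; ring)
    (fun _ _ _ => by simp only [Prod.fst_add, Prod.snd_add]; ring)
    (fun _ _ _ => by simp only [Prod.smul_fst, Prod.smul_snd, smul_eq_mul]; ring)

theorem qubitForm_apply (u v : ZMod 2 × ZMod 2) : qubitForm u v = u.1 * v.2 + u.2 * v.1 := rfl

/-- The Pauli matrices of one qubit. -/
def qubitPauli (u : ZMod 2 × ZMod 2) : Matrix (ZMod 2) (ZMod 2) ℂ :=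
  Matrix.of fun x y => if x = y + u.1 then sgn (u.2 * y) else 0

theorem qubitPauli_mul (u v : ZMod 2 × ZMod 2) :
    qubitPauli u * qubitPauli v = sgn (u.2 * v.1) • qubitPauli (u + v) := by
  ext x y
  rw [Matrix.mul_apply, Finset.sum_eq_single (y + v.1)]
  · simp only [qubitPauli, Matrix.of_apply, Matrix.smul_apply, Prod.fst_add, Prod.snd_add, if_true,
      smul_eq_mul]
    rw [show y + v.1 + u.1 = y + (u.1 + v.1) by ring]
    split_ifs
    · rw [← sgn_add, ← sgn_add]
      congr 1
      ring
    · simp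
  · intro b _ hb
    simp [qubitPauli, hb]
  · simp

theorem qubitPauli_zero : qubitPauli 0 = 1 := by
  ext x y
  simp [qubitPauli, Matrix.one_apply]

/-- The matrices `X ^ u₁ Z ^ u₂` are used without the factor `i` that would make them all Hermitian.
All phases stay signs, at the price of squares `-1` and eigenvalues `±i`. -/
theorem isErrorBasis_qubit : IsErrorBasis qubitForm qubitPauli where
  zero := qubitPauli_zero
  mul u v := ⟨_, qubitPauli_mul u v⟩
  unitary u := by
    have h : (qubitPauli u)ᴴ = sgn (u.2 * u.1) • qubitPauli u := by
      ext x y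
      simp only [qubitPauli, Matrix.conjTranspose_apply, Matrix.of_apply, Matrix.smul_apply]
      by_cases hxy : x = y + u.1
      · have hyx : y = x + u.1 := by rw [hxy, add_assoc, CharTwo.add_self_eq_zero, add_zero]
        rw [if_pos hxy, if_pos hyx, star_sgn, smul_eq_mul, ← sgn_add, hxy]
        congr 1
        ring
      · have hyx : ¬ y = x + u.1 := fun h => hxy <| by
          rw [h, add_assoc, CharTwo.add_self_eq_zero, add_zero]
        simp [hxy, hyx]
    rw [h, Matrix.smul_mul, qubitPauli_mul, smul_smul, sgn_mul_self, one_smul,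
      CharTwo.add_self_eq_zero u, qubitPauli_zero]
  comm u v := by
    rw [qubitPauli_mul, qubitPauli_mul, smul_smul, add_comm v u, ← sgn_add, qubitForm_apply]
    congr 2
    have := CharTwo.add_self_eq_zero (v.2 * u.1)
    linear_combination -this
  trace u hu := by
    rw [Matrix.trace]
    simp only [qubitPauli, Matrix.diag_apply, Matrix.of_apply]
    by_cases h1 : u.1 = 0
    · have h2 : u.2 = 1 := zmod_two_eq_one fun h2 => hu (Prod.ext h1 h2)
      have : (Finset.univ : Finset (ZMod 2)) = {0, 1} := by decide
      simp [h1, h2, this]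
    · simp [h1]

section Tensor

variable {ι I : Type*} [Fintype ι]

/-- The tensor product of a family of matrices. -/
def tensor (A : ι → Matrix I I ℂ) : Matrix (ι → I) (ι → I) ℂ :=
  Matrix.of fun x y => ∏ i, A i (x i) (y i)

theorem tensor_mul [Fintype I] [DecidableEq ι] (A B : ι → Matrix I I ℂ) :
    tensor A * tensor B = tensor fun i => A i * B i := by
  ext x y
  simp only [tensor, Matrix.mul_apply, Matrix.of_apply, Finset.prod_univ_sum,
    Fintype.piFinset_univ, Finset.prod_mul_distrib]

theorem tensor_one [DecidableEq I] : tensor (fun _ : ι => (1 : Matrix I I ℂ)) = 1 := by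
  ext x y
  simp only [tensor, Matrix.of_apply, Matrix.one_apply]
  by_cases h : x = y
  · simp [h]
  · obtain ⟨i, hi⟩ := Function.ne_iff.mp h
    rw [if_neg h]
    exact Finset.prod_eq_zero (Finset.mem_univ i) (if_neg hi)

theorem tensor_conjTranspose (A : ι → Matrix I I ℂ) :
    (tensor A)ᴴ = tensor fun i => (A i)ᴴ := by
  ext x y
  simp [tensor, Matrix.conjTranspose_apply]

theorem tensor_smul (c : ι → ℂ) (A : ι → Matrix I I ℂ) :
    tensor (fun i => c i • A i) = (∏ i, c i) • tensor A := by
  ext x y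
  simp [tensor, Finset.prod_mul_distrib]

theorem trace_tensor [Fintype I] [DecidableEq ι] (A : ι → Matrix I I ℂ) :
    (tensor A).trace = ∏ i, (A i).trace := by
  simp only [Matrix.trace, tensor, Matrix.diag_apply, Matrix.of_apply, Finset.prod_univ_sum,
    Fintype.piFinset_univ]

variable {V : Type*} [AddCommGroup V] [Module (ZMod 2) V]

/-- The orthogonal sum of copies of a bilinear form. -/
def piForm (ι : Type*) [Fintype ι] (ω : LinearMap.BilinForm (ZMod 2) V) :
    LinearMap.BilinForm (ZMod 2) (ι → V) :=
  ∑ i, ω.compl₁₂ (LinearMap.proj i) (LinearMap.proj i)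

theorem piForm_apply (ω : LinearMap.BilinForm (ZMod 2) V) (u v : ι → V) :
    piForm ι ω u v = ∑ i, ω (u i) (v i) := by
  simp [piForm, LinearMap.sum_apply]

theorem piForm_isAlt {ω : LinearMap.BilinForm (ZMod 2) V} (h : ω.IsAlt) : (piForm ι ω).IsAlt := by
  intro u
  rw [piForm_apply]
  exact Finset.sum_eq_zero fun i _ => h _

theorem IsErrorBasis.tensor [Fintype I] [DecidableEq I] [DecidableEq ι] {ω : LinearMap.BilinForm (ZMod 2) V}
    {p : V → Matrix I I ℂ} (h : IsErrorBasis ω p) :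
    IsErrorBasis (piForm ι ω) fun u => EAQ.tensor fun i => p (u i) where
  zero := by simp only [Pi.zero_apply, h.zero, tensor_one]
  mul u v := by
    choose c hc using h.mul
    refine ⟨∑ i, c (u i) (v i), ?_⟩
    rw [tensor_mul, sgn_sum, ← tensor_smul]
    simp only [hc, Pi.add_apply]
  unitary u := by
    rw [tensor_conjTranspose, tensor_mul]
    simp only [h.unitary, tensor_one]
  comm u v := by
    rw [tensor_mul, tensor_mul, piForm_apply, sgn_sum, ← tensor_smul]
    simp only [← h.comm]
  trace u hu := by
    obtain ⟨i, hi⟩ := Function.ne_iff.mp hu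
    rw [trace_tensor]
    exact Finset.prod_eq_zero (Finset.mem_univ i) (h.trace _ hi)

end Tensor

section Basic

variable {I : Type*} [Fintype I] [DecidableEq I]
variable {V : Type*} [AddCommGroup V] [Module (ZMod 2) V]
variable {ω : LinearMap.BilinForm (ZMod 2) V} {P : V → Matrix I I ℂ}

theorem IsErrorBasis.comp (h : IsErrorBasis ω P) {V' : Type*} [AddCommGroup V']
    [Module (ZMod 2) V'] {ω' : LinearMap.BilinForm (ZMod 2) V'} (φ : V' →ₗ[ZMod 2] V)
    (hφ : Function.Injective φ) (hω : ∀ u v, ω (φ u) (φ v) = ω' u v) :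
    IsErrorBasis ω' fun u => P (φ u) where
  zero := by rw [map_zero, h.zero]
  mul u v := by simpa only [map_add] using h.mul (φ u) (φ v)
  unitary u := h.unitary _
  comm u v := by rw [h.comm, hω]
  trace u hu := h.trace _ fun h0 => hu (hφ (by rw [h0, map_zero]))

theorem IsErrorBasis.reindex (h : IsErrorBasis ω P) {I' : Type*} [Fintype I'] [DecidableEq I']
    (e : I' ≃ I) : IsErrorBasis ω fun u => (P u).submatrix e e where
  zero := by simp only [h.zero, Matrix.submatrix_one_equiv]
  mul u v := by
    obtain ⟨c, hc⟩ := h.mul u v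
    exact ⟨c, by rw [Matrix.submatrix_mul_equiv, hc]; rfl⟩
  unitary u := by
    rw [Matrix.conjTranspose_submatrix, Matrix.submatrix_mul_equiv, h.unitary,
      Matrix.submatrix_one_equiv]
  comm u v := by
    rw [Matrix.submatrix_mul_equiv, Matrix.submatrix_mul_equiv, h.comm]; rfl
  trace u hu := by
    rw [← h.trace u hu]
    exact e.sum_comp fun i => P u i i

theorem add_self_eq_zero_of_zmod_two (u : V) : u + u = 0 := by
  have h : ((1 : ZMod 2) + 1) • u = u + u := by rw [add_smul, one_smul]
  rw [← h, show (1 + 1 : ZMod 2) = 0 by decide, zero_smul]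

theorem IsErrorBasis.mul_self (h : IsErrorBasis ω P) (u : V) : ∃ c, P u * P u = sgn c • 1 := by
  obtain ⟨c, hc⟩ := h.mul u u
  exact ⟨c, by rw [hc, add_self_eq_zero_of_zmod_two, h.zero]⟩

theorem IsErrorBasis.linearIndependent [Nonempty I] [Fintype V] (h : IsErrorBasis ω P) :
    LinearIndependent ℂ P := by
  rw [Fintype.linearIndependent_iff]
  intro g hg u
  -- Multiplying by `P u` and taking the trace isolates the coefficient of `P u`, since `P u * P v`
  -- is a multiple of the identity only for `v = u`.
  have h1 := congrArg (fun M => (P u * M).trace) hg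
  simp only [Finset.mul_sum, Matrix.mul_smul, Matrix.trace_sum, Matrix.trace_smul, mul_zero,
    Matrix.trace_zero] at h1
  rw [Finset.sum_eq_single u] at h1
  · obtain ⟨c, hc⟩ := h.mul_self u
    rw [hc, Matrix.trace_smul, Matrix.trace_one] at h1
    simpa [sgn_ne_zero] using h1
  · intro v _ hv
    obtain ⟨c, hc⟩ := h.mul u v
    rw [hc, Matrix.trace_smul, h.trace, smul_zero, smul_zero]
    intro huv
    apply hv
    have := add_self_eq_zero_of_zmod_two u
    rw [← huv] at this
    exact (add_left_cancel this).symm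
  · simp

theorem IsErrorBasis.exists_eq_sum [Nonempty I] [Fintype V] (h : IsErrorBasis ω P)
    (hcard : Fintype.card V = Fintype.card I ^ 2) (M : Matrix I I ℂ) :
    ∃ c : V → ℂ, M = ∑ u, c u • P u := by
  have hspan : Submodule.span ℂ (Set.range P) = ⊤ :=
    h.linearIndependent.span_eq_top_of_card_eq_finrank' (by
      rw [hcard, Module.finrank_matrix, Module.finrank_self, sq, mul_one])
  have hM : M ∈ Submodule.span ℂ (Set.range P) := hspan ▸ Submodule.mem_top
  obtain ⟨c, hc⟩ := (Submodule.mem_span_range_iff_exists_fun ℂ).1 hM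
  exact ⟨c, hc.symm⟩

theorem star_dotProduct_unitary {U : Matrix I I ℂ} (hU : Uᴴ * U = 1) (v w : I → ℂ) :
    star (U *ᵥ v) ⬝ᵥ (U *ᵥ w) = star v ⬝ᵥ w := by
  rw [Matrix.star_mulVec, ← Matrix.dotProduct_mulVec, Matrix.mulVec_mulVec, hU, Matrix.one_mulVec]

/-- Induction on the set: if `A² = μ²` then `A v + μ v` is either zero or an eigenvector of `A` for
`μ`, and it remains an eigenvector of everything commuting with `A`. -/
theorem exists_common_eigenvector [Nonempty I] (S : Finset (Matrix I I ℂ))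
    (hcomm : ∀ A ∈ S, ∀ B ∈ S, A * B = B * A) (hsq : ∀ A ∈ S, ∃ c : ℂ, A * A = c • 1) :
    ∃ v : I → ℂ, v ≠ 0 ∧ ∀ A ∈ S, ∃ χ : ℂ, A *ᵥ v = χ • v := by
  induction S using Finset.induction_on with
  | empty => exact ⟨1, one_ne_zero, by simp⟩
  | insert A S _ ih =>
    obtain ⟨v, hv0, hv⟩ := ih
      (fun B hB B' hB' => hcomm B (Finset.mem_insert_of_mem hB) B' (Finset.mem_insert_of_mem hB'))
      (fun B hB => hsq B (Finset.mem_insert_of_mem hB))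
    obtain ⟨c, hc⟩ := hsq A (Finset.mem_insert_self _ _)
    obtain ⟨μ, hμ⟩ := IsAlgClosed.exists_pow_nat_eq c (n := 2) two_pos
    by_cases hw : A *ᵥ v + μ • v = 0
    · refine ⟨v, hv0, Finset.forall_mem_insert _ _ _ |>.2 ⟨⟨-μ, ?_⟩, hv⟩⟩
      rw [neg_smul]
      exact eq_neg_of_add_eq_zero_left hw
    · refine ⟨_, hw, Finset.forall_mem_insert _ _ _ |>.2 ⟨⟨μ, ?_⟩, fun B hB => ?_⟩⟩
      · rw [Matrix.mulVec_add, Matrix.mulVec_mulVec, hc, Matrix.smul_mulVec, Matrix.one_mulVec,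
          Matrix.mulVec_smul, smul_add, smul_smul, ← sq, hμ, add_comm]
      · obtain ⟨χ, hχ⟩ := hv B hB
        refine ⟨χ, ?_⟩
        rw [Matrix.mulVec_add, Matrix.mulVec_mulVec,
          hcomm B (Finset.mem_insert_of_mem hB) A (Finset.mem_insert_self _ _),
          ← Matrix.mulVec_mulVec, Matrix.mulVec_smul, hχ, Matrix.mulVec_smul, smul_add,
          smul_comm μ χ v]

theorem exists_unit_smul {I : Type*} [Fintype I] {v : I → ℂ} (hv : v ≠ 0) : ∃ c : ℂ, star (c • v) ⬝ᵥ (c • v) = 1 := by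
  have h1 : star v ⬝ᵥ v = ((∑ i, ‖v i‖ ^ 2 : ℝ) : ℂ) := by
    simp only [dotProduct, Pi.star_apply, Complex.ofReal_sum]
    refine Finset.sum_congr rfl fun i _ => ?_
    rw [Complex.star_def, mul_comm, Complex.mul_conj, Complex.normSq_eq_norm_sq]
  have hpos : 0 < ∑ i, ‖v i‖ ^ 2 := by
    obtain ⟨i, hi⟩ := Function.ne_iff.mp hv
    exact Finset.sum_pos' (fun _ _ => by positivity)
      ⟨i, Finset.mem_univ i, by have := norm_pos_iff.2 hi; positivity⟩
  refine ⟨((Real.sqrt (∑ i, ‖v i‖ ^ 2))⁻¹ : ℝ), ?_⟩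
  rw [star_smul, smul_dotProduct, dotProduct_smul, h1, smul_eq_mul, smul_eq_mul, Complex.star_def,
    Complex.conj_ofReal, ← Complex.ofReal_mul, ← Complex.ofReal_mul, ← mul_assoc, ← mul_inv,
    Real.mul_self_sqrt hpos.le, inv_mul_cancel₀ hpos.ne', Complex.ofReal_one]

end Basic

end ErrorBasis

/-! ### The entangled stabilizer code of a symplectic frame. -/

section EntangledCode

open Matrix

variable {I V : Type*} [Fintype I] [DecidableEq I] [AddCommGroup V] [Module (ZMod 2) V]
variable {ω : LinearMap.BilinForm (ZMod 2) V} {P : V → Matrix I I ℂ}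

/-- The linear combination of a family with coefficients in `ZMod 2`. -/
def comb {a : ℕ} (x : Fin a → V) (b : Fin a → ZMod 2) : V := ∑ i, b i • x i

theorem comb_add {a : ℕ} (x : Fin a → V) (b b' : Fin a → ZMod 2) :
    comb x (b + b') = comb x b + comb x b' := by
  simp [comb, add_smul, Finset.sum_add_distrib]

theorem comb_zero {a : ℕ} (x : Fin a → V) : comb x 0 = 0 := by simp [comb]

theorem comb_single {a : ℕ} (x : Fin a → V) (j : Fin a) : comb x (Pi.single j 1) = x j := by
  rw [comb, Finset.sum_eq_single j]
  · simp
  · intro i _ hi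
    simp [Pi.single_eq_of_ne hi]
  · simp

/-- `v` is an eigenvector of the error `P u`. -/
def IsEigen (P : V → Matrix I I ℂ) (v : I → ℂ) (u : V) : Prop := ∃ χ : ℂ, P u *ᵥ v = χ • v

theorem IsErrorBasis.isEigen_add (h : IsErrorBasis ω P) {v : I → ℂ} {u u' : V}
    (hu : IsEigen P v u) (hu' : IsEigen P v u') : IsEigen P v (u + u') := by
  obtain ⟨χ, hχ⟩ := hu
  obtain ⟨χ', hχ'⟩ := hu'
  obtain ⟨c, hc⟩ := h.mul u u'
  refine ⟨sgn c * (χ' * χ), ?_⟩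
  have h1 := congrArg (fun M => sgn c • (M *ᵥ v)) hc
  simp only [Matrix.smul_mulVec, smul_smul, sgn_mul_self, one_smul] at h1
  rw [← h1, ← Matrix.mulVec_mulVec, hχ', Matrix.mulVec_smul, hχ, smul_smul, smul_smul, mul_assoc]

theorem IsErrorBasis.isEigen_zero (h : IsErrorBasis ω P) (v : I → ℂ) : IsEigen P v 0 :=
  ⟨1, by rw [h.zero, Matrix.one_mulVec, one_smul]⟩

theorem IsErrorBasis.isEigen_comb (h : IsErrorBasis ω P) {v : I → ℂ} {k : ℕ}
    (z : Fin k → V) (a : Fin k → ZMod 2) (hz : ∀ i, IsEigen P v (z i)) :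
    IsEigen P v (comb z a) := by
  refine Finset.sum_induction _ _ (fun _ _ => h.isEigen_add) (h.isEigen_zero v) fun i _ => ?_
  by_cases ha : a i = 0
  · simpa [ha] using h.isEigen_zero v
  · simpa [zmod_two_eq_one ha] using hz i

theorem IsErrorBasis.star_mul_eigenvalue (h : IsErrorBasis ω P) {v : I → ℂ}
    (hv : star v ⬝ᵥ v = 1) {u : V} {χ : ℂ} (hχ : P u *ᵥ v = χ • v) : star χ * χ = 1 := by
  have h1 := star_dotProduct_unitary (h.unitary u) v v
  rw [hχ, star_smul, smul_dotProduct, dotProduct_smul, hv] at h1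
  simpa using h1

theorem IsErrorBasis.mulVec_comm (h : IsErrorBasis ω P) (u u' : V) (v : I → ℂ) :
    P u *ᵥ (P u' *ᵥ v) = sgn (ω u u') • (P u' *ᵥ (P u *ᵥ v)) := by
  rw [Matrix.mulVec_mulVec, h.comm, Matrix.smul_mulVec, ← Matrix.mulVec_mulVec]

/-- Eigenvectors of `P a` with suitable eigenvalues are not connected by an error `P u`. -/
theorem IsErrorBasis.dotProduct_eq_zero (h : IsErrorBasis ω P) {w w' : I → ℂ} {a u : V} {χ χ' : ℂ}
    (hw : P a *ᵥ w = χ • w) (hw' : P a *ᵥ w' = χ' • w')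
    (hχ : star χ * χ' * sgn (ω a u) = -1) : star w ⬝ᵥ (P u *ᵥ w') = 0 := by
  -- Inserting the unitary `P a` on both sides multiplies the matrix element by `star χ * χ' * sgn
  -- (ω a u) = -1`.
  have h1 := star_dotProduct_unitary (h.unitary a) w (P u *ᵥ w')
  rw [h.mulVec_comm, hw', hw, star_smul, smul_dotProduct, dotProduct_smul, Matrix.mulVec_smul,
    dotProduct_smul, smul_eq_mul, smul_eq_mul, smul_eq_mul] at h1
  have h2 : star w ⬝ᵥ (P u *ᵥ w') = (star χ * χ' * sgn (ω a u)) * (star w ⬝ᵥ (P u *ᵥ w')) := by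
    rw [show star χ * χ' * sgn (ω a u) = star χ * (sgn (ω a u) * χ') by ring, mul_assoc, mul_assoc,
      h1]
  rw [hχ] at h2
  linear_combination h2 / 2

/-- Hyperbolic families `(x, z)`, for the receiver's qubits, and `(x', z')`, for the message, and
an isotropic space `R`, all orthogonal to each other. -/
structure IsSymplecticFrame (ω : LinearMap.BilinForm (ZMod 2) V) {a m : ℕ} (R : Submodule (ZMod 2) V)
    (x z : Fin a → V) (x' z' : Fin m → V) : Prop where
  hyp : IsHyperbolic ω x z
  hyp' : IsHyperbolic ω x' z'
  rr : ∀ u ∈ R, ∀ v ∈ R, ω u v = 0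
  rx : ∀ u ∈ R, ∀ i, ω u (x i) = 0
  rz : ∀ u ∈ R, ∀ i, ω u (z i) = 0
  rx' : ∀ u ∈ R, ∀ i, ω u (x' i) = 0
  rz' : ∀ u ∈ R, ∀ i, ω u (z' i) = 0
  xx' : ∀ i j, ω (x i) (x' j) = 0
  xz' : ∀ i j, ω (x i) (z' j) = 0
  zx' : ∀ i j, ω (z i) (x' j) = 0
  zz' : ∀ i j, ω (z i) (z' j) = 0

theorem apply_comb_eq_zero {a : ℕ} {x : Fin a → V} {u : V} (h : ∀ i, ω u (x i) = 0)
    (b : Fin a → ZMod 2) : ω u (comb x b) = 0 := by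
  simp [comb, h]

/-- The codeword `P(x b) P(x' m) v` for the message `m` and the receiver's basis state `b`. -/
def codeword (P : V → Matrix I I ℂ) {a k : ℕ} (x : Fin a → V) (x' : Fin k → V) (v : I → ℂ)
    (m : Fin k → ZMod 2) (b : Fin a → ZMod 2) : I → ℂ :=
  P (comb x b) *ᵥ (P (comb x' m) *ᵥ v)

theorem IsErrorBasis.mulVec_codeword (h : IsErrorBasis ω P) {a k : ℕ} {x : Fin a → V}
    {x' : Fin k → V} {v : I → ℂ} {u : V} {χ : ℂ} (hu : P u *ᵥ v = χ • v) (m : Fin k → ZMod 2)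
    (b : Fin a → ZMod 2) : P u *ᵥ codeword P x x' v m b =
      (sgn (ω u (comb x b) + ω u (comb x' m)) * χ) • codeword P x x' v m b := by
  rw [codeword, h.mulVec_comm, h.mulVec_comm u (comb x' m), hu, sgn_add]
  simp only [Matrix.mulVec_smul, smul_smul]
  congr 1; ring

section Frame

variable {a k : ℕ} {R : Submodule (ZMod 2) V} {x z : Fin a → V} {x' z' : Fin k → V}

/-- `R`, the `z i` and the `z' i` are mutually orthogonal, so their errors commute and have a joint
eigenvector. -/
theorem exists_stabilizer_state [Nonempty I] [Finite V] (h : IsErrorBasis ω P) (hω : ω.IsAlt)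
    (hf : IsSymplecticFrame ω R x z x' z') : ∃ v : I → ℂ, star v ⬝ᵥ v = 1 ∧
      (∀ u ∈ R, IsEigen P v u) ∧ (∀ i, IsEigen P v (z i)) ∧ ∀ i, IsEigen P v (z' i) := by
  classical
  have symm : ∀ {u v}, ω u v = 0 → ω v u = 0 := fun {u v} h => by rw [← hω.neg_eq, h, neg_zero]
  let L : Set V := R ∪ Set.range z ∪ Set.range z'
  have hL : ∀ u ∈ L, ∀ v ∈ L, ω u v = 0 := by
    rintro u ((hu | ⟨i, rfl⟩) | ⟨i, rfl⟩) v ((hv | ⟨j, rfl⟩) | ⟨j, rfl⟩)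
    · exact hf.rr u hu v hv
    · exact hf.rz u hu j
    · exact hf.rz' u hu j
    · exact symm (hf.rz v hv i)
    · exact hf.hyp.zz i j
    · exact hf.zz' i j
    · exact symm (hf.rz' v hv i)
    · exact symm (hf.zz' j i)
    · exact hf.hyp'.zz i j
  have hfin : (P '' L).Finite := (Set.toFinite L).image P
  obtain ⟨w, hw0, hw⟩ := exists_common_eigenvector hfin.toFinset
    (by
      intro A hA B hB
      rw [Set.Finite.mem_toFinset] at hA hB
      obtain ⟨u, hu, rfl⟩ := hA
      obtain ⟨v, hv, rfl⟩ := hB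
      rw [h.comm, hL u hu v hv, sgn_zero, one_smul])
    (by
      intro A hA
      rw [Set.Finite.mem_toFinset] at hA
      obtain ⟨u, hu, rfl⟩ := hA
      obtain ⟨c, hc⟩ := h.mul_self u
      exact ⟨_, hc⟩)
  obtain ⟨c, hc⟩ := exists_unit_smul hw0
  have key : ∀ u ∈ L, IsEigen P (c • w) u := by
    intro u hu
    obtain ⟨χ, hχ⟩ := hw (P u) (hfin.mem_toFinset.2 ⟨u, hu, rfl⟩)
    exact ⟨χ, by rw [Matrix.mulVec_smul, hχ, smul_comm]⟩
  exact ⟨c • w, hc, fun u hu => key u (Or.inl (Or.inl hu)),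
    fun i => key _ (Or.inl (Or.inr ⟨i, rfl⟩)), fun i => key _ (Or.inr ⟨i, rfl⟩)⟩

variable {v : I → ℂ}

theorem codeword_self (h : IsErrorBasis ω P) (hv : star v ⬝ᵥ v = 1) (m : Fin k → ZMod 2)
    (b : Fin a → ZMod 2) :
    star (codeword P x x' v m b) ⬝ᵥ codeword P x x' v m b = 1 := by
  rw [codeword, star_dotProduct_unitary (h.unitary _), star_dotProduct_unitary (h.unitary _), hv]

/-- The eigenvalue of `P (z j)` on a codeword records the bit `b j`; likewise `P (z' j)` records `m
j`. Distinct codewords are separated in this way. -/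
theorem apply_z_comb (hω : ω.IsAlt) (hf : IsSymplecticFrame ω R x z x' z') (j : Fin a)
    (b : Fin a → ZMod 2) (m : Fin k → ZMod 2) :
    ω (z j) (comb x b) + ω (z j) (comb x' m) = b j := by
  rw [apply_comb_eq_zero (hf.zx' j), comb, hf.hyp.apply_sum_x' hω, add_zero, ZMod.neg_eq_self_mod_two]

theorem apply_z'_comb (hω : ω.IsAlt) (hf : IsSymplecticFrame ω R x z x' z') (j : Fin k)
    (b : Fin a → ZMod 2) (m : Fin k → ZMod 2) :
    ω (z' j) (comb x b) + ω (z' j) (comb x' m) = m j := by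
  rw [apply_comb_eq_zero, comb, hf.hyp'.apply_sum_x' hω, zero_add, ZMod.neg_eq_self_mod_two]
  intro i
  rw [← hω.neg_eq, hf.xz', neg_zero]

theorem sgn_mul_sgn_of_ne {s t : ZMod 2} (h : s ≠ t) : sgn s * sgn t = -1 := by
  rw [← sgn_add]
  refine sgn_of_ne_zero fun h0 => h ?_
  rw [← sub_eq_zero, CharTwo.sub_eq_add, h0]

theorem codeword_orthogonal (h : IsErrorBasis ω P) (hω : ω.IsAlt)
    (hf : IsSymplecticFrame ω R x z x' z') (hv : star v ⬝ᵥ v = 1)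
    (hz : ∀ i, IsEigen P v (z i)) (hz' : ∀ i, IsEigen P v (z' i)) {m m' : Fin k → ZMod 2}
    {b b' : Fin a → ZMod 2} (hne : (m, b) ≠ (m', b')) :
    star (codeword P x x' v m b) ⬝ᵥ codeword P x x' v m' b' = 0 := by
  have key : ∀ u : V, IsEigen P v u →
      ω u (comb x b) + ω u (comb x' m) ≠ ω u (comb x b') + ω u (comb x' m') →
      star (codeword P x x' v m b) ⬝ᵥ codeword P x x' v m' b' = 0 := by
    rintro u ⟨χ, hχ⟩ hu
    have := h.dotProduct_eq_zero (u := 0) (h.mulVec_codeword hχ m b) (h.mulVec_codeword hχ m' b') (by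
      rw [map_zero, sgn_zero, mul_one, star_mul', star_sgn, mul_mul_mul_comm,
        h.star_mul_eigenvalue hv hχ, sgn_mul_sgn_of_ne hu, mul_one])
    rwa [h.zero, Matrix.one_mulVec] at this
  by_cases hb : b = b'
  · have hm : m ≠ m' := fun hm => hne (by rw [hm, hb])
    obtain ⟨j, hj⟩ := Function.ne_iff.mp hm
    refine key _ (hz' j) ?_
    rwa [apply_z'_comb hω hf, apply_z'_comb hω hf]
  · obtain ⟨j, hj⟩ := Function.ne_iff.mp hb
    refine key _ (hz j) ?_
    rwa [apply_z_comb hω hf, apply_z_comb hω hf]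

/-- The matrix elements, averaged over the receiver's states, of an error that anticommutes with an
element of the stabilizer of the receiver's extended code vanish. -/
theorem sum_codeword_eq_zero (h : IsErrorBasis ω P) (hω : ω.IsAlt)
    (hf : IsSymplecticFrame ω R x z x' z') (hv : star v ⬝ᵥ v = 1)
    (hR : ∀ u ∈ R, IsEigen P v u) (hz : ∀ i, IsEigen P v (z i)) {u : V}
    (hu : (∃ w ∈ R, ω w u ≠ 0) ∨ (∃ j, ω (z j) u ≠ 0) ∨ ∃ j, ω (x j) u ≠ 0)
    (m m' : Fin k → ZMod 2) :
    ∑ b, star (codeword P x x' v m b) ⬝ᵥ (P u *ᵥ codeword P x x' v m' b) = 0 := by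
  have key : ∀ w : V, IsEigen P v w → ω w u ≠ 0 → (∀ b, ω w (comb x b) + ω w (comb x' m) =
      ω w (comb x b) + ω w (comb x' m')) → 
      ∑ b, star (codeword P x x' v m b) ⬝ᵥ (P u *ᵥ codeword P x x' v m' b) = 0 := by
    rintro w ⟨χ, hχ⟩ hw heq
    refine Finset.sum_eq_zero fun b _ => ?_
    refine h.dotProduct_eq_zero (h.mulVec_codeword hχ m b) (h.mulVec_codeword hχ m' b) ?_
    rw [heq b, star_mul', star_sgn, mul_mul_mul_comm, sgn_mul_self, h.star_mul_eigenvalue hv hχ,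
      sgn_of_ne_zero hw]
    ring
  rcases hu with ⟨w, hw, hwu⟩ | ⟨j, hj⟩ | ⟨j, hj⟩
  · refine key w (hR w hw) hwu fun b => ?_
    rw [apply_comb_eq_zero (hf.rx' w hw), apply_comb_eq_zero (hf.rx' w hw)]
  · refine key _ (hz j) hj fun b => ?_
    rw [apply_z_comb hω hf, apply_z_comb hω hf]
  -- Here the codewords are not eigenvectors. Instead `P (x j)` shifts `b j`, which permutes the
  -- terms of the sum, and moving it past `P u` costs a sign; hence `S = -S`.
  · set S := ∑ b, star (codeword P x x' v m b) ⬝ᵥ (P u *ᵥ codeword P x x' v m' b) with hS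
    have hshift : ∀ b, ∃ c, ∀ m, codeword P x x' v m (b + Pi.single j 1) =
        sgn c • P (x j) *ᵥ codeword P x x' v m b := by
      intro b
      obtain ⟨c, hc⟩ := h.mul (x j) (comb x b)
      refine ⟨c, fun m => ?_⟩
      rw [codeword, codeword, Matrix.mulVec_mulVec _ (P (x j)), hc, Matrix.smul_mulVec, smul_smul,
        sgn_mul_self, one_smul, comb_add, comb_single, add_comm]
    have hneg : S = -S := by
      refine (Equiv.sum_comp (Equiv.addRight (Pi.single j 1 : Fin a → ZMod 2)) _).symm.trans ?_
      rw [hS, ← Finset.sum_neg_distrib]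
      refine Finset.sum_congr rfl fun b _ => ?_
      obtain ⟨c, hc⟩ := hshift b
      have huj : ω u (x j) ≠ 0 := fun h0 => hj (by rw [← hω.neg_eq, h0, neg_zero])
      rw [Equiv.coe_addRight, hc, hc, star_smul, smul_dotProduct, Matrix.mulVec_smul,
        dotProduct_smul, smul_smul, star_sgn, sgn_mul_self, one_smul, h.mulVec_comm u,
        dotProduct_smul, star_dotProduct_unitary (h.unitary _), sgn_of_ne_zero huj, neg_one_smul]
    linear_combination hneg / 2

/-- An error in `C` acts on the message alone: it adds `m₀` and gives the sign `(-1) ^ (m₁ · m)`,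
with the same factor for every `b`. The extra sign `t` comes from the projective multiplication;
that it disappears for `m₀ = 0` is what makes the phase legible in that case. -/
theorem mulVec_codeword_shift (h : IsErrorBasis ω P) (hω : ω.IsAlt)
    (hf : IsSymplecticFrame ω R x z x' z') (hv : star v ⬝ᵥ v = 1)
    (hR : ∀ u ∈ R, IsEigen P v u) (hz' : ∀ i, IsEigen P v (z' i)) {r : V} (hr : r ∈ R)
    (m₀ m₁ : Fin k → ZMod 2) : ∃ γ : ℂ, γ ≠ 0 ∧ ∀ m, ∃ t : ZMod 2, (m₀ = 0 → t = 0) ∧ ∀ b,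
      P (r + comb z' m₁ + comb x' m₀) *ᵥ codeword P x x' v m b =
        (sgn (t + ∑ j, m₁ j * m j) * γ) • codeword P x x' v (m + m₀) b := by
  obtain ⟨χ, hχ⟩ := h.isEigen_add (hR r hr) (h.isEigen_comb z' m₁ hz')
  obtain ⟨c, hc⟩ := h.mul (comb x' m₀) (r + comb z' m₁)
  have hχ0 : χ ≠ 0 := by
    rintro rfl
    simpa using h.star_mul_eigenvalue hv hχ
  refine ⟨sgn c * χ, mul_ne_zero (sgn_ne_zero c) hχ0, fun m => ?_⟩
  obtain ⟨c', hc'⟩ := h.mul (comb x' m) (comb x' m₀)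
  have hc0 : m₀ = 0 → c' = 0 := by
    rintro rfl
    rw [comb_zero, h.zero, mul_one, add_zero] at hc'
    -- A sign `-1` would give `P = -P`, so `P = 0`, against unitarity.
    by_contra hne
    rw [sgn_of_ne_zero hne, neg_one_smul] at hc'
    have h1 : P (comb x' m) = 0 := by
      have := add_eq_zero_iff_eq_neg.2 hc'
      rw [← two_smul ℂ] at this
      exact (smul_eq_zero.1 this).resolve_left two_ne_zero
    have h2 := h.star_mul_eigenvalue hv (u := comb x' m) (χ := 0) (by simp [h1])
    simp at h2
  refine ⟨c', hc0, fun b => ?_⟩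
  set u := r + comb z' m₁ + comb x' m₀ with hu
  have hub : ω u (comb x b) = 0 := by
    rw [hu, map_add, map_add, LinearMap.add_apply, LinearMap.add_apply,
      apply_comb_eq_zero (hf.rx r hr), apply_comb_eq_zero, apply_comb_eq_zero, add_zero, add_zero]
    · intro i
      rw [← hω.neg_eq, apply_comb_eq_zero (hf.xx' i), neg_zero]
    · intro i
      rw [← hω.neg_eq, apply_comb_eq_zero (hf.xz' i), neg_zero]
  have hum : ω u (comb x' m) = ∑ j, m₁ j * m j := by
    rw [hu, map_add, map_add, LinearMap.add_apply, LinearMap.add_apply,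
      apply_comb_eq_zero (hf.rx' r hr), apply_comb_eq_zero (u := comb x' m₀), zero_add, add_zero]
    · rw [comb, map_sum, LinearMap.sum_apply]
      refine Finset.sum_congr rfl fun j _ => ?_
      rw [map_smul, LinearMap.smul_apply, comb, hf.hyp'.apply_sum_x' hω, ZMod.neg_eq_self_mod_two,
        smul_eq_mul]
    · intro i
      rw [← hω.neg_eq, apply_comb_eq_zero (hf.hyp'.xx i), neg_zero]
  have huv : P u *ᵥ v = (sgn c * χ) • (P (comb x' m₀) *ᵥ v) := by
    have h1 := congrArg (fun M => sgn c • (M *ᵥ v)) hc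
    simp only [Matrix.smul_mulVec, smul_smul, sgn_mul_self, one_smul] at h1
    rw [hu, add_comm (r + comb z' m₁), ← h1, ← Matrix.mulVec_mulVec, hχ,
      Matrix.mulVec_smul, smul_smul]
  rw [codeword, h.mulVec_comm, hub, sgn_zero, one_smul, h.mulVec_comm u (comb x' m), hum, huv,
    Matrix.mulVec_smul (P (comb x' m)), Matrix.mulVec_mulVec _ (P (comb x' m)), hc', Matrix.smul_mulVec, codeword,
    comb_add, sgn_add]
  simp only [Matrix.mulVec_smul, smul_smul]
  congr 1; ring

/-- The matrix elements, averaged over the receiver's states, of a nontrivial logical error do not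
form a scalar matrix. -/
theorem sum_codeword_not_scalar (h : IsErrorBasis ω P) (hω : ω.IsAlt)
    (hf : IsSymplecticFrame ω R x z x' z') (hv : star v ⬝ᵥ v = 1)
    (hR : ∀ u ∈ R, IsEigen P v u) (hz' : ∀ i, IsEigen P v (z' i)) {r : V}
    (hr : r ∈ R) {m₀ m₁ : Fin k → ZMod 2} (hne : m₀ ≠ 0 ∨ m₁ ≠ 0) (ζ : ℂ)
    (hζ : ∀ m m', ∑ b, star (codeword P x x' v m b) ⬝ᵥ
      (P (r + comb z' m₁ + comb x' m₀) *ᵥ codeword P x x' v m' b) = if m = m' then ζ else 0) :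
    False := by
  obtain ⟨γ, hγ, hP⟩ := mulVec_codeword_shift h hω hf hv hR hz' hr m₀ m₁
  have key : ∀ m, ∃ t : ZMod 2, (m₀ = 0 → t = 0) ∧
      (Fintype.card (Fin a → ZMod 2)) * (sgn (t + ∑ j, m₁ j * m j) * γ) =
        if m + m₀ = m then ζ else 0 := by
    intro m
    obtain ⟨t, ht, htP⟩ := hP m
    refine ⟨t, ht, ?_⟩
    rw [← hζ (m + m₀) m]
    simp only [htP, dotProduct_smul, codeword_self h hv, smul_eq_mul, mul_one, Finset.sum_const,
      Finset.card_univ, nsmul_eq_mul]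
  have hcard : ((Fintype.card (Fin a → ZMod 2) : ℕ) : ℂ) ≠ 0 := by
    exact_mod_cast Fintype.card_ne_zero
  -- If `m₀ = 0`, the diagonal entries at the messages `0` and `Pi.single j 1` have opposite signs;
  -- otherwise an off-diagonal entry is nonzero.
  by_cases h0 : m₀ = 0
  · obtain ⟨j, hj⟩ := Function.ne_iff.mp (hne.resolve_left (not_not.2 h0))
    obtain ⟨t, ht, h1⟩ := key 0
    obtain ⟨t', ht', h2⟩ := key (Pi.single j 1)
    rw [ht h0] at h1
    rw [ht' h0] at h2
    simp only [h0, add_zero, if_true, Pi.zero_apply, mul_zero, Finset.sum_const_zero, sgn_zero,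
      one_mul, zero_add] at h1 h2
    rw [Finset.sum_eq_single j (fun i _ hi => by rw [Pi.single_eq_of_ne hi, mul_zero]) (by simp),
      Pi.single_eq_same, mul_one, sgn_of_ne_zero hj, ← h1] at h2
    have : (Fintype.card (Fin a → ZMod 2) : ℂ) * γ = 0 := by linear_combination -h2 / 2
    exact mul_ne_zero hcard hγ this
  · obtain ⟨t, -, h1⟩ := key 0
    rw [zero_add, if_neg h0] at h1
    exact mul_ne_zero hcard (mul_ne_zero (sgn_ne_zero _) hγ) h1

end Frame

end EntangledCode

/-! ### The Knill–Laflamme conditions and the quantum code of a symplectic pair of codes. -/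

section Existence

open Matrix

/-- The matrix in the Knill–Laflamme condition, as a sum over the receiver's basis states. -/
theorem EAEncoder.encoding_apply {q n k c : ℕ} (𝒬 : EAEncoder q n k c)
    (E : Matrix (Fin n → Fin q) (Fin n → Fin q) ℂ) (m m' : Fin k → Fin q) :
    (𝒬.encoding.conjTranspose * (E ⊗ₖ (1 : Matrix (Fin c → Fin q) (Fin c → Fin q) ℂ)) *
      𝒬.encoding) m m' = ((q : ℂ) ^ c)⁻¹ *
      ∑ b, star (fun x => 𝒬.V x (m, b)) ⬝ᵥ (E *ᵥ fun y => 𝒬.V y (m', b)) := by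
  have hs : (((Real.sqrt ((q : ℝ) ^ c) : ℝ) : ℂ))⁻¹ * (((Real.sqrt ((q : ℝ) ^ c) : ℝ) : ℂ))⁻¹ =
      ((q : ℂ) ^ c)⁻¹ := by
    rw [← mul_inv, ← Complex.ofReal_mul, Real.mul_self_sqrt (by positivity)]
    simp
  rw [Matrix.mul_assoc, Matrix.mul_apply, Fintype.sum_prod_type, Finset.sum_comm, Finset.mul_sum]
  refine Finset.sum_congr rfl fun b _ => ?_
  rw [dotProduct, Finset.mul_sum]
  refine Finset.sum_congr rfl fun x _ => ?_
  have h1 : ((E ⊗ₖ (1 : Matrix (Fin c → Fin q) (Fin c → Fin q) ℂ)) * 𝒬.encoding) (x, b) m' =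
      (((Real.sqrt ((q : ℝ) ^ c) : ℝ) : ℂ))⁻¹ * (E *ᵥ fun y => 𝒬.V y (m', b)) x := by
    rw [Matrix.mul_apply, Fintype.sum_prod_type, Matrix.mulVec, dotProduct, Finset.mul_sum]
    refine Finset.sum_congr rfl fun y _ => ?_
    rw [Finset.sum_eq_single b]
    · simp only [Matrix.kronecker_apply, Matrix.one_apply_eq, EAEncoder.encoding]
      ring
    · intro b' _ hb'
      simp [Matrix.one_apply_ne (Ne.symm hb')]
    · simp
  rw [h1, ← hs, Matrix.conjTranspose_apply, EAEncoder.encoding, Pi.star_apply]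
  simp only [star_div₀, Complex.star_def, Complex.conj_ofReal]
  ring

theorem EAEncoder.detects_iff {q n k c : ℕ} (hq : q ≠ 0) (𝒬 : EAEncoder q n k c)
    (E : Matrix (Fin n → Fin q) (Fin n → Fin q) ℂ) :
    𝒬.Detects E ↔ ∃ ζ : ℂ, ∀ m m', ∑ b, star (fun x => 𝒬.V x (m, b)) ⬝ᵥ
      (E *ᵥ fun y => 𝒬.V y (m', b)) = if m = m' then ζ else 0 := by
  have hq' : ((q : ℂ) ^ c) ≠ 0 := pow_ne_zero _ (Nat.cast_ne_zero.2 hq)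
  constructor
  · rintro ⟨ζ, h⟩
    refine ⟨(q : ℂ) ^ c * ζ, fun m m' => ?_⟩
    have h1 := congrFun (congrFun h m) m'
    rw [EAEncoder.encoding_apply, Matrix.smul_apply, Matrix.one_apply] at h1
    rw [← mul_right_inj' (inv_ne_zero hq'), h1]
    split_ifs
    · rw [inv_mul_cancel_left₀ hq', smul_eq_mul, mul_one]
    · simp
  · rintro ⟨ζ, h⟩
    refine ⟨((q : ℂ) ^ c)⁻¹ * ζ, ?_⟩
    ext m m'
    rw [EAEncoder.encoding_apply, h, Matrix.smul_apply, Matrix.one_apply]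
    split_ifs <;> simp

theorem EAEncoder.detects_sum {q n k c : ℕ} (𝒬 : EAEncoder q n k c) {ι : Type*} (s : Finset ι)
    (a : ι → ℂ) (E : ι → Matrix (Fin n → Fin q) (Fin n → Fin q) ℂ)
    (h : ∀ i ∈ s, 𝒬.Detects (E i)) : 𝒬.Detects (∑ i ∈ s, a i • E i) := by
  choose! ζ hζ using h
  refine ⟨∑ i ∈ s, a i * ζ i, ?_⟩
  have h1 : ((∑ i ∈ s, a i • E i) ⊗ₖ (1 : Matrix (Fin c → Fin q) (Fin c → Fin q) ℂ)) =
      ∑ i ∈ s, a i • (E i ⊗ₖ (1 : Matrix (Fin c → Fin q) (Fin c → Fin q) ℂ)) := by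
    ext x y
    simp [Matrix.sum_apply, Finset.sum_mul, mul_assoc]
  rw [h1, Matrix.mul_sum, Matrix.sum_mul, Finset.sum_smul]
  refine Finset.sum_congr rfl fun i hi => ?_
  rw [Matrix.mul_smul, Matrix.smul_mul, hζ i hi, smul_smul]

variable {G : Type*} [AddCommGroup G] [Module (ZMod 2) G]

/-- The set of coordinates at which a word is nonzero. -/
def wordSupport {n : ℕ} [DecidableEq G] (u : Fin n → G) : Finset (Fin n) := {i | u i ≠ 0}

theorem actsOn_tensor [DecidableEq G] {q n : ℕ} {ω : LinearMap.BilinForm (ZMod 2) G}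
    {p : G → Matrix (Fin q) (Fin q) ℂ} (hp : IsErrorBasis ω p) (u : Fin n → G) :
    EAEncoder.ActsOn (wordSupport u) (tensor fun i => p (u i)) := by
  refine ⟨tensor fun i => p (u i), fun x y => ⟨fun h => ?_, fun h => ?_⟩⟩
  · simp only [tensor, Matrix.of_apply]
    rw [← Finset.prod_subset (Finset.subset_univ (wordSupport u)), ← Finset.prod_coe_sort]
    intro i _ hi
    have hui : u i = 0 := by simpa [wordSupport] using hi
    rw [hui, hp.zero, h i hi, Matrix.one_apply_eq]
  · push Not at h
    obtain ⟨i, hi, hxy⟩ := h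
    have hui : u i = 0 := by simpa [wordSupport] using hi
    refine Finset.prod_eq_zero (Finset.mem_univ i) ?_
    change p (u i) (x i) (y i) = 0
    rw [hui, hp.zero, Matrix.one_apply_ne hxy]

/-- The error basis on the qudits of `T` spans all operators there, so detection need only be
checked on basis errors supported in `T`. -/
theorem exists_eq_sum_of_actsOn {q n : ℕ} [NeZero q] [Fintype G]
    {ω : LinearMap.BilinForm (ZMod 2) G}
    {p : G → Matrix (Fin q) (Fin q) ℂ} (hp : IsErrorBasis ω p) (hcard : Fintype.card G = q ^ 2)
    {T : Finset (Fin n)} {E : Matrix (Fin n → Fin q) (Fin n → Fin q) ℂ}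
    (hE : EAEncoder.ActsOn T E) :
    ∃ a : (T → G) → ℂ, E = ∑ u, a u •
      tensor fun i => p (if h : i ∈ T then u ⟨i, h⟩ else 0) := by
  obtain ⟨M, hM⟩ := hE
  have hcard' : Fintype.card (T → G) = Fintype.card (T → Fin q) ^ 2 := by
    rw [Fintype.card_fun, Fintype.card_fun, hcard, Fintype.card_fin, ← pow_mul, ← pow_mul, mul_comm]
  obtain ⟨a, ha⟩ := (hp.tensor (ι := T)).exists_eq_sum hcard' M
  refine ⟨a, ?_⟩
  ext x y
  simp only [Matrix.sum_apply, Matrix.smul_apply]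
  by_cases h : ∀ i, i ∉ T → x i = y i
  · rw [(hM x y).1 h, ha]
    simp only [Matrix.sum_apply, Matrix.smul_apply]
    refine Finset.sum_congr rfl fun u _ => ?_
    congr 1
    simp only [tensor, Matrix.of_apply]
    have h1 : ∏ i, p (if h : i ∈ T then u ⟨i, h⟩ else 0) (x i) (y i) =
        ∏ i ∈ T, p (if h : i ∈ T then u ⟨i, h⟩ else 0) (x i) (y i) := by
      refine (Finset.prod_subset (Finset.subset_univ T) fun i _ hi => ?_).symm
      rw [dif_neg hi, hp.zero, h i hi, Matrix.one_apply_eq]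
    rw [h1, ← Finset.prod_coe_sort T]
    refine Finset.prod_congr rfl fun i _ => ?_
    rw [dif_pos i.2]
  · rw [(hM x y).2 h]
    push Not at h
    obtain ⟨i, hi, hxy⟩ := h
    refine (Finset.sum_eq_zero fun u _ => ?_).symm
    have : tensor (fun i => p (if h : i ∈ T then u ⟨i, h⟩ else 0)) x y = 0 := by
      refine Finset.prod_eq_zero (Finset.mem_univ i) ?_
      change p _ (x i) (y i) = 0
      rw [dif_neg hi, hp.zero, Matrix.one_apply_ne hxy]
    rw [this, smul_zero]

/-- An entanglement-assisted code from a pair of dual codes `C` and `D`, when the minimum distance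
of `C` is attained outside `D`. -/
theorem existsEAQEC_of_orthogonal [DecidableEq G] {q n k c d e : ℕ} [Fintype G] (hq : q = 2 ^ e)
    {ω : LinearMap.BilinForm (ZMod 2) G} (hω : ω.IsAlt)
    {p : G → Matrix (Fin q) (Fin q) ℂ} (hp : IsErrorBasis ω p) (hcard : Fintype.card G = q ^ 2)
    (C D : Submodule (ZMod 2) (Fin n → G))
    (hD : D = (piForm (Fin n) ω).orthogonal C) (hC : C = (piForm (Fin n) ω).orthogonal D)
    (hk : Module.finrank (ZMod 2) C = Module.finrank (ZMod 2) (C ⊓ D : Submodule _ _) + 2 * (e * k))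
    (hc : Module.finrank (ZMod 2) D = Module.finrank (ZMod 2) (C ⊓ D : Submodule _ _) + 2 * (e * c))
    (hmin : ∀ u ∈ C, u ≠ 0 → d ≤ (wordSupport u).card) (hd : ∃ u ∈ C, u ∉ D ∧ (wordSupport u).card = d) :
    ExistsEAQEC q n k d c := by
  have : NeZero q := ⟨by rw [hq]; positivity⟩
  set B := piForm (Fin n) ω with hB
  have hBalt : B.IsAlt := piForm_isAlt hω
  have hP := hp.tensor (ι := Fin n)
  obtain ⟨a, x, z, hx, hz, hyp, hrad⟩ := exists_isHyperbolic B hBalt D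
  obtain ⟨l, x', z', hx', hz', hyp', hrad'⟩ := exists_isHyperbolic B hBalt C
  have ha : a = e * c := by
    have := hyp.finrank_eq hBalt D hx hz hrad
    rw [← hC, inf_comm, hc] at this
    omega
  have hl : l = e * k := by
    have := hyp'.finrank_eq hBalt C hx' hz' hrad'
    rw [← hD, hk] at this
    omega
  have hCD : ∀ u ∈ C, ∀ v ∈ D, B u v = 0 := fun u hu v hv => by
    rw [hD] at hv; exact hv u hu
  have hDC : ∀ u ∈ D, ∀ v ∈ C, B u v = 0 := fun u hu v hv => by
    rw [hC] at hv; exact hv u hu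
  have hf : IsSymplecticFrame B (C ⊓ D) x z x' z' :=
    { hyp := hyp
      hyp' := hyp'
      rr := fun u hu v hv => hCD u hu.1 v hv.2
      rx := fun u hu i => hCD u hu.1 _ (hx i)
      rz := fun u hu i => hCD u hu.1 _ (hz i)
      rx' := fun u hu i => hDC u hu.2 _ (hx' i)
      rz' := fun u hu i => hDC u hu.2 _ (hz' i)
      xx' := fun i j => hDC _ (hx i) _ (hx' j)
      xz' := fun i j => hDC _ (hx i) _ (hz' j)
      zx' := fun i j => hDC _ (hz i) _ (hx' j)
      zz' := fun i j => hDC _ (hz i) _ (hz' j) }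
  obtain ⟨v, hv, hvR, hvz, hvz'⟩ := exists_stabilizer_state hP hBalt hf
  -- Any bijection of `q`-ary with binary labels serves: only an orthonormal basis of codewords is
  -- needed.
  obtain ⟨μ⟩ : Nonempty ((Fin k → Fin q) ≃ (Fin l → ZMod 2)) := ⟨Fintype.equivOfCardEq (by
    simp [ZMod.card, hq, hl, pow_mul])⟩
  obtain ⟨β⟩ : Nonempty ((Fin c → Fin q) ≃ (Fin a → ZMod 2)) := ⟨Fintype.equivOfCardEq (by
    simp [ZMod.card, hq, ha, pow_mul])⟩
  let P : (Fin n → G) → Matrix (Fin n → Fin q) (Fin n → Fin q) ℂ :=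
    fun u => tensor fun i => p (u i)
  let 𝒬 : EAEncoder q n k c :=
    { V := Matrix.of fun y mb => codeword P x x' v (μ mb.1) (β mb.2) y
      isometry := by
        ext ⟨m, b⟩ ⟨m', b'⟩
        change star (codeword P x x' v (μ m) (β b)) ⬝ᵥ codeword P x x' v (μ m') (β b') = _
        by_cases h : (m, b) = (m', b')
        · obtain ⟨rfl, rfl⟩ := Prod.mk.inj h
          rw [codeword_self hP hv, Matrix.one_apply_eq]
        · rw [Matrix.one_apply_ne h]
          refine codeword_orthogonal hP hBalt hf hv hvz hvz' fun h' => h ?_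
          obtain ⟨h1, h2⟩ := Prod.mk.inj h'
          rw [μ.injective h1, β.injective h2] }
  have hq0 : q ≠ 0 := NeZero.ne q
  have hsum : ∀ E m m', ∑ b, star (fun x => 𝒬.V x (m, b)) ⬝ᵥ (E *ᵥ fun y => 𝒬.V y (m', b)) =
      ∑ b, star (codeword P x x' v (μ m) b) ⬝ᵥ (E *ᵥ codeword P x x' v (μ m') b) :=
    fun E m m' => β.sum_comp fun b =>
      star (codeword P x x' v (μ m) b) ⬝ᵥ (E *ᵥ codeword P x x' v (μ m') b)
  have hdet : ∀ u, (wordSupport u).card < d → 𝒬.Detects (P u) := by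
    intro u hu
    rw [EAEncoder.detects_iff hq0]
    simp only [hsum]
    by_cases huC : u ∈ C
    · have hu0 : u = 0 := by
        by_contra h0
        exact absurd (hmin u huC h0) (not_le.2 hu)
      refine ⟨Fintype.card (Fin a → ZMod 2), fun m m' => ?_⟩
      have hP0 : P u = 1 := by rw [hu0]; exact hP.zero
      simp only [hP0, Matrix.one_mulVec]
      split_ifs with h
      · rw [h, Finset.sum_congr rfl fun b _ => codeword_self hP hv _ _, Finset.sum_const,
          Finset.card_univ, nsmul_eq_mul, mul_one]
      · refine Finset.sum_eq_zero fun b _ => codeword_orthogonal hP hBalt hf hv hvz hvz' ?_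
        exact fun h' => h (μ.injective (Prod.mk.inj h').1)
    · refine ⟨0, fun m m' => ?_⟩
      rw [ite_self]
      refine sum_codeword_eq_zero hP hBalt hf hv hvR hvz ?_ _ _
      by_contra hno
      push Not at hno
      obtain ⟨h1, h2, h3⟩ := hno
      apply huC
      rw [hC]
      intro w hw
      change B w u = 0
      -- Modulo the `x i` and `z i`, every `w ∈ D` is its projection, which lies in the radical `C ⊓
      -- D`. Hence an error orthogonal to that radical, to `x` and to `z` is orthogonal to `D`, that
      -- is, lies in `C`.
      have hr := hrad _ (IsHyperbolic.proj_mem D hx hz hw) (fun i => hyp.apply_x_proj hBalt i w)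
        (fun i => hyp.apply_z_proj hBalt i w)
      have hr' : IsHyperbolic.proj B x z w ∈ C ⊓ D := by
        refine ⟨?_, IsHyperbolic.proj_mem D hx hz hw⟩
        rw [hC]
        intro w' hw'
        change B w' _ = 0
        rw [← hBalt.neg_eq, hr w' hw', neg_zero]
      have h4 := h1 _ hr'
      simpa [IsHyperbolic.proj, h2, h3] using h4
  refine ⟨𝒬, ⟨?_, ?_⟩⟩
  · obtain ⟨u, huC, huD, rfl⟩ := hd
    refine ⟨wordSupport u, rfl, P u, actsOn_tensor hp u, ?_⟩
    rw [EAEncoder.detects_iff hq0]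
    simp only [hsum]
    rintro ⟨ζ, hζ⟩
    set r := IsHyperbolic.proj B x' z' u with hr
    have hr' : r ∈ C ⊓ D := by
      refine ⟨IsHyperbolic.proj_mem C hx' hz' huC, ?_⟩
      rw [hD]
      intro w' hw'
      change B w' _ = 0
      rw [← hBalt.neg_eq, hrad' _ (IsHyperbolic.proj_mem C hx' hz' huC)
        (fun i => hyp'.apply_x_proj hBalt i u) (fun i => hyp'.apply_z_proj hBalt i u) w' hw',
        neg_zero]
    -- Undoing the projection, with signs immaterial in characteristic 2.
    have hu : u = r + comb z' (fun i => B u (x' i)) + comb x' (fun i => B u (z' i)) := by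
      have h2 := add_self_eq_zero_of_zmod_two (comb z' fun i => B u (x' i))
      rw [hr, IsHyperbolic.proj]
      change u = u - comb x' _ + comb z' _ + comb z' _ + comb x' _
      rw [add_assoc (u - _), h2]
      abel
    have hne : (fun i => B u (z' i)) ≠ 0 ∨ (fun i => B u (x' i)) ≠ 0 := by
      by_contra hno
      push Not at hno
      rw [hno.1, hno.2, comb_zero, comb_zero, add_zero, add_zero] at hu
      exact huD (hu ▸ hr'.2)
    refine sum_codeword_not_scalar hP hBalt hf hv hvR hvz' hr' hne ζ fun m m' => ?_
    have := hζ (μ.symm m) (μ.symm m')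
    simp only [Equiv.apply_symm_apply, EmbeddingLike.apply_eq_iff_eq] at this
    rw [← this, ← hu]
  · rintro w ⟨T, rfl, E, hE, hnot⟩
    by_contra hlt
    push Not at hlt
    apply hnot
    obtain ⟨b, rfl⟩ := exists_eq_sum_of_actsOn hp hcard hE
    refine 𝒬.detects_sum _ _ _ fun u _ => hdet _ ?_
    refine lt_of_le_of_lt (Finset.card_le_card fun i hi => ?_) hlt
    by_contra hiT
    simp [wordSupport, hiT] at hi

end Existence

/-! ### The trace-Hermitian form as symplectic form of a qudit. -/

section TraceForm

theorem nondegenerate_of_isAlt {k V : Type*} [Field k] [AddCommGroup V] [Module k V]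
    {B : LinearMap.BilinForm k V} (hB : B.IsAlt) (h : ∀ u, (∀ v, B u v = 0) → u = 0) :
    B.Nondegenerate :=
  ⟨h, fun v hv => h v fun u => by rw [← hB.neg_eq, hv, neg_zero]⟩

theorem piForm_nondegenerate {ι V : Type*} [Fintype ι] [AddCommGroup V] [Module (ZMod 2) V]
    {ω : LinearMap.BilinForm (ZMod 2) V} (hω : ω.IsAlt) (h : ω.Nondegenerate) :
    (piForm ι ω).Nondegenerate := by
  classical
  refine nondegenerate_of_isAlt (piForm_isAlt hω) fun u hu => funext fun i => h.1 _ fun x => ?_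
  have := hu (Pi.single i x)
  rw [piForm_apply, Finset.sum_eq_single i] at this
  · simpa using this
  · intro j _ hj
    rw [Pi.single_eq_of_ne hj, map_zero]
  · simp

/-- Every nondegenerate symplectic space of dimension `2 e` over `ZMod 2` has an error basis of
matrices of size `2 ^ e`. -/
theorem exists_isErrorBasis {V : Type*} [AddCommGroup V] [Module (ZMod 2) V]
    [FiniteDimensional (ZMod 2) V] {ω : LinearMap.BilinForm (ZMod 2) V} (hω : ω.IsAlt)
    (hnd : ω.Nondegenerate) {e : ℕ} (he : Module.finrank (ZMod 2) V = 2 * e) :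
    ∃ p : V → Matrix (Fin (2 ^ e)) (Fin (2 ^ e)) ℂ, IsErrorBasis ω p := by
  obtain ⟨m, x, z, -, -, hyp, hrad⟩ := exists_isHyperbolic ω hω ⊤
  have hm : m = e := by
    have h1 := hyp.finrank_eq hω ⊤ (fun _ => trivial) (fun _ => trivial) hrad
    have h2 : (⊤ ⊓ ω.orthogonal ⊤ : Submodule (ZMod 2) V) = ⊥ := by
      rw [top_inf_eq, LinearMap.BilinForm.orthogonal_top_eq_bot hnd]
    rw [h2, finrank_bot, finrank_top, he] at h1
    omega
  subst hm
  let φ : V →ₗ[ZMod 2] (Fin m → ZMod 2 × ZMod 2) :=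
    LinearMap.pi fun i => (ω (z i)).prod (ω (x i))
  have hswap : ∀ u v, ω u v = ω v u := fun u v => by
    rw [← hω.neg_eq, ZMod.neg_eq_self_mod_two]
  have hφ : ∀ u v, piForm (Fin m) qubitForm (φ u) (φ v) = ω u v := by
    intro u v
    have h0 : ω (IsHyperbolic.proj ω x z u) v = 0 :=
      hrad _ trivial (fun i => hyp.apply_x_proj hω i u) (fun i => hyp.apply_z_proj hω i u) v trivial
    rw [IsHyperbolic.proj, map_add, map_sub, LinearMap.add_apply, LinearMap.sub_apply] at h0
    simp only [map_sum, map_smul, LinearMap.sum_apply, LinearMap.smul_apply, smul_eq_mul] at h0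
    rw [piForm_apply]
    have h1 : ∀ i, qubitForm (φ u i) (φ v i) = ω u (z i) * ω (x i) v + ω u (x i) * ω (z i) v := by
      intro i
      change ω (z i) u * ω (x i) v + ω (x i) u * ω (z i) v = _
      rw [hswap (z i) u, hswap (x i) u]
    simp only [h1, Finset.sum_add_distrib]
    have h2 := CharTwo.add_self_eq_zero (∑ i, ω u (x i) * ω (z i) v)
    linear_combination h2 - h0
  have hinj : Function.Injective φ := by
    rw [← LinearMap.ker_eq_bot, LinearMap.ker_eq_bot']
    intro u hu
    refine hnd.1 u fun v => ?_
    rw [← hφ, hu, map_zero, LinearMap.zero_apply]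
  obtain ⟨μ⟩ : Nonempty (Fin (2 ^ m) ≃ (Fin m → ZMod 2)) :=
    ⟨Fintype.equivOfCardEq (by simp [ZMod.card])⟩
  exact ⟨_, ((isErrorBasis_qubit.tensor (ι := Fin m)).comp φ hinj hφ).reindex μ⟩

theorem pow_card_eq_self {F : Type*} [Field F] [Finite F] {e : ℕ} (hF : Nat.card F = (2 ^ e) ^ 2) (x : F) :
    (x ^ 2 ^ e) ^ 2 ^ e = x := by
  have := Fintype.ofFinite F
  rw [← pow_mul, ← sq, ← hF, Nat.card_eq_fintype_card, FiniteField.pow_card]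

variable (F : Type*) [Field F] [Algebra (ZMod 2) F]

/-- The map `x ↦ x ^ (2 ^ e)` as a linear map over the prime field. -/
noncomputable def frobLinear (e : ℕ) : F →ₗ[ZMod 2] F :=
  haveI : CharP F 2 := charP_of_injective_algebraMap' (ZMod 2) 2
  (iterateFrobenius F 2 e).toAddMonoidHom.toZModLinearMap 2

/-- The trace-Hermitian form `Tr (x y ^ q)` on the field with `q ^ 2` elements, `q = 2 ^ e`. -/
noncomputable def hermForm (e : ℕ) : LinearMap.BilinForm (ZMod 2) F :=
  (Algebra.traceForm (ZMod 2) F).compl₂ (frobLinear F e)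

theorem hermForm_apply (e : ℕ) (x y : F) :
    hermForm F e x y = Algebra.trace (ZMod 2) F (x * y ^ 2 ^ e) := rfl

variable {F} [Finite F]

theorem finrank_zmod_two {e : ℕ} (hF : Nat.card F = (2 ^ e) ^ 2) :
    Module.finrank (ZMod 2) F = 2 * e := by
  have h := Module.natCard_eq_pow_finrank (K := ZMod 2) (V := F)
  rw [hF, Nat.card_zmod, ← pow_mul, mul_comm] at h
  exact (Nat.pow_right_injective le_rfl h).symm

/-- The norm `x ^ (q + 1)` lies in the subfield with `q` elements, so each of its conjugates occurs
twice in the trace. -/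
theorem hermForm_isAlt {e : ℕ} (hF : Nat.card F = (2 ^ e) ^ 2) : (hermForm F e).IsAlt := by
  have : CharP F 2 := charP_of_injective_algebraMap' (ZMod 2) 2
  intro x
  apply FaithfulSMul.algebraMap_injective (ZMod 2) F
  rw [hermForm_apply, FiniteField.algebraMap_trace_eq_sum_pow, finrank_zmod_two hF, two_mul,
    Finset.sum_range_add, ← Finset.sum_add_distrib, map_zero]
  refine Finset.sum_eq_zero fun i _ => ?_
  rw [Nat.card_zmod, pow_add, pow_mul _ (2 ^ e), mul_pow x (x ^ 2 ^ e) (2 ^ e),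
    pow_card_eq_self hF, mul_comm (x ^ 2 ^ e) x,
    CharTwo.add_self_eq_zero]

theorem hermForm_nondegenerate {e : ℕ} (hF : Nat.card F = (2 ^ e) ^ 2) :
    (hermForm F e).Nondegenerate := by
  refine nondegenerate_of_isAlt (hermForm_isAlt hF) fun x hx => ?_
  refine (traceForm_nondegenerate (ZMod 2) F).1 x fun y => ?_
  have := hx (y ^ 2 ^ e)
  rwa [hermForm_apply, pow_card_eq_self hF] at this

/-- The symplectic dual of a linear code is any linear code of complementary dimension that is
orthogonal to it for the Hermitian inner product. -/
theorem orthogonal_eq_of_hermitian {n e : ℕ} (hF : Nat.card F = (2 ^ e) ^ 2)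
    (C D : Submodule F (Fin n → F)) (hdim : Module.finrank F C + Module.finrank F D = n)
    (horth : ∀ c ∈ C, ∀ d ∈ D, ∑ i, c i * d i ^ 2 ^ e = 0) :
    D.restrictScalars (ZMod 2) =
      (piForm (Fin n) (hermForm F e)).orthogonal (C.restrictScalars (ZMod 2)) := by
  have hnd := piForm_nondegenerate (ι := Fin n) (hermForm_isAlt hF) (hermForm_nondegenerate hF)
  have hfin : ∀ W : Submodule F (Fin n → F), Module.finrank (ZMod 2) (W.restrictScalars (ZMod 2)) =
      2 * e * Module.finrank F W := by
    intro W
    rw [← finrank_zmod_two hF]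
    exact (Module.finrank_mul_finrank (ZMod 2) F W).symm
  have hV : Module.finrank (ZMod 2) (Fin n → F) = 2 * e * n := by
    rw [Module.finrank_pi_fintype, Finset.sum_const, finrank_zmod_two hF, Finset.card_univ,
      Fintype.card_fin, smul_eq_mul, mul_comm]
  refine Submodule.eq_of_le_of_finrank_eq ?_ ?_
  · intro d hd c hc
    change piForm (Fin n) (hermForm F e) c d = 0
    rw [piForm_apply]
    simp only [hermForm_apply]
    rw [← map_sum, horth c hc d hd, map_zero]
  -- Hermitian orthogonality gives only an inclusion; the dimensions over the prime field give
  -- equality.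
  · rw [LinearMap.BilinForm.finrank_orthogonal hnd, hfin, hfin, hV]
    have := congrArg (2 * e * ·) hdim
    simp only [mul_add] at this
    omega

end TraceForm

/-! ### Constacyclic codes through their roots, and the BCH bound. -/

section RootCode

open Polynomial

variable {F K : Type*} [Field F] [Field K] [Algebra F K]

theorem wordPoly_add {n : ℕ} (c d : Fin n → F) : wordPoly (c + d) = wordPoly c + wordPoly d := by
  simp [wordPoly, add_mul, Finset.sum_add_distrib]

theorem wordPoly_smul {n : ℕ} (a : F) (c : Fin n → F) : wordPoly (a • c) = a • wordPoly c := by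
  simp [wordPoly, Finset.smul_sum, smul_eq_C_mul, mul_assoc]

theorem aeval_wordPoly {n : ℕ} (c : Fin n → F) (ρ : K) :
    aeval ρ (wordPoly c) = ∑ i : Fin n, algebraMap F K (c i) * ρ ^ (i : ℕ) := by
  simp [wordPoly]

theorem wordPoly_coeff {n : ℕ} {p : F[X]} (hp : p.natDegree < n) :
    wordPoly (fun i : Fin n => p.coeff i) = p := by
  rw [wordPoly, Fin.sum_univ_eq_sum_range (fun i => C (p.coeff i) * X ^ i) n]
  simpa only [C_mul_X_pow_eq_monomial] using (p.as_sum_range' n hp).symm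

/-- The polynomial of a word as a linear map. -/
noncomputable def wordPolyLinear (F : Type*) [Field F] (n : ℕ) : (Fin n → F) →ₗ[F] F[X] where
  toFun := wordPoly
  map_add' := wordPoly_add
  map_smul' := wordPoly_smul

/-- The code of the words whose polynomials vanish on `Y`. -/
def rootCode (F : Type*) {K : Type*} [Field F] [Field K] [Algebra F K] (n : ℕ) (Y : Finset K) :
    Submodule F (Fin n → F) where
  carrier := {c | ∀ ρ ∈ Y, aeval ρ (wordPoly c) = 0}
  add_mem' hc hd ρ hρ := by rw [wordPoly_add, map_add, hc ρ hρ, hd ρ hρ, add_zero]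
  zero_mem' ρ _ := by simp [wordPoly]
  smul_mem' a c hc ρ hρ := by rw [wordPoly_smul, map_smul, hc ρ hρ, smul_zero]

theorem mem_rootCode {n : ℕ} {Y : Finset K} {c : Fin n → F} :
    c ∈ rootCode F n Y ↔ ∀ ρ ∈ Y, aeval ρ (wordPoly c) = 0 := Iff.rfl

theorem aeval_constacyclicShift {n : ℕ} {α : F} {ρ : K} (hρ : ρ ^ n = algebraMap F K α)
    (c : Fin n → F) :
    aeval ρ (wordPoly (constacyclicShift α c)) = ρ * aeval ρ (wordPoly c) := by
  rw [aeval_wordPoly, aeval_wordPoly]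
  cases n with
  | zero => simp
  | succ n =>
    rw [Fin.sum_univ_succ, Fin.sum_univ_castSucc (n := n), mul_add, Finset.mul_sum, add_comm]
    congr 1
    · refine Finset.sum_congr rfl fun i _ => ?_
      have : constacyclicShift α c i.succ = c i.castSucc := by
        simp only [constacyclicShift, Fin.val_succ, Nat.succ_ne_zero, if_false,
          Nat.add_sub_cancel]
        rfl
      rw [this, Fin.val_succ, Fin.val_castSucc, pow_succ]
      ring
    · have : constacyclicShift α c 0 = α * c (Fin.last n) := by
        simp only [constacyclicShift, Fin.val_zero, if_true, Nat.add_sub_cancel]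
        rfl
      rw [this, map_mul, ← hρ, Fin.val_zero, Fin.val_last, pow_succ]
      ring

theorem rootCode_isConstacyclic {n : ℕ} {α : F} {Y : Finset K}
    (hY : ∀ ρ ∈ Y, ρ ^ n = algebraMap F K α) : IsConstacyclic α (rootCode F n Y) := by
  intro c hc ρ hρ
  rw [aeval_constacyclicShift (hY ρ hρ), hc ρ hρ, mul_zero]

theorem prod_X_sub_C_dvd_map_iff (Y : Finset K) (p : F[X]) :
    ∏ ρ ∈ Y, (X - C ρ) ∣ p.map (algebraMap F K) ↔ ∀ ρ ∈ Y, aeval ρ p = 0 := by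
  have hroot : ∀ ρ, X - C ρ ∣ p.map (algebraMap F K) ↔ aeval ρ p = 0 := fun ρ => by
    rw [dvd_iff_isRoot, IsRoot, eval_map_algebraMap]
  constructor
  · intro h ρ hρ
    exact (hroot ρ).1 ((Finset.dvd_prod_of_mem (fun ρ => X - C ρ) hρ).trans h)
  · intro h
    refine Finset.prod_dvd_of_coprime ?_ fun ρ hρ => (hroot ρ).2 (h ρ hρ)
    intro a _ b _ hab
    exact isCoprime_X_sub_C_of_isUnit_sub (sub_ne_zero.2 hab).isUnit

section Generator

variable {n : ℕ} {Y : Finset K} {g : F[X]}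

theorem dvd_iff_of_map_eq (hg : g.map (algebraMap F K) = ∏ ρ ∈ Y, (X - C ρ)) (p : F[X]) :
    g ∣ p ↔ ∀ ρ ∈ Y, aeval ρ p = 0 := by
  rw [← map_dvd_map' (algebraMap F K), hg, prod_X_sub_C_dvd_map_iff]

theorem natDegree_of_map_eq (hg : g.map (algebraMap F K) = ∏ ρ ∈ Y, (X - C ρ)) :
    g.natDegree = Y.card := by
  rw [← natDegree_map (algebraMap F K), hg, natDegree_prod_of_monic _ _ fun ρ _ => monic_X_sub_C ρ]
  simp

theorem isGeneratorPoly_rootCode {α : F} (hg : g.map (algebraMap F K) = ∏ ρ ∈ Y, (X - C ρ))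
    (hmonic : g.Monic) (hY : ∀ ρ ∈ Y, ρ ^ n = algebraMap F K α) :
    IsGeneratorPoly α (rootCode F n Y) g := by
  refine ⟨hmonic, (dvd_iff_of_map_eq hg _).2 fun ρ hρ => ?_, fun c => ?_⟩
  · simp [hY ρ hρ]
  · rw [dvd_iff_of_map_eq hg, mem_rootCode]

/-- The code is the kernel of the surjection from words to `F[X] / (g)`. -/
theorem finrank_of_generator {C : Submodule F (Fin n → F)} (hmonic : g.Monic)
    (hn : g.natDegree ≤ n) (hC : ∀ c : Fin n → F, c ∈ C ↔ g ∣ wordPoly c) :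
    Module.finrank F C + g.natDegree = n := by
  let f : (Fin n → F) →ₗ[F] AdjoinRoot g :=
    (AdjoinRoot.mkₐ g).toLinearMap.comp (wordPolyLinear F n)
  have hf : ∀ c, f c = AdjoinRoot.mk g (wordPoly c) := fun c => rfl
  have hsurj : Function.Surjective f := by
    intro y
    obtain ⟨p, rfl⟩ := AdjoinRoot.mk_surjective y
    -- For `g = 1` the remainder has degree no smaller than that of `g`, so the degree bound fails,
    -- but the quotient is trivial.
    by_cases hg1 : g = 1
    · refine ⟨0, ?_⟩
      rw [hf, AdjoinRoot.mk_eq_mk, hg1]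
      exact one_dvd _
    refine ⟨fun i => (p %ₘ g).coeff i, ?_⟩
    rw [hf, wordPoly_coeff ((natDegree_modByMonic_lt p hmonic hg1).trans_le hn), AdjoinRoot.mk_eq_mk]
    exact ⟨-(p /ₘ g), by linear_combination modByMonic_add_div p g⟩
  have hker : LinearMap.ker f = C := by
    ext c
    rw [LinearMap.mem_ker, hf, AdjoinRoot.mk_eq_zero, hC]
  have hrank := LinearMap.finrank_range_add_finrank_ker f
  rw [LinearMap.range_eq_top.2 hsurj, finrank_top, hker, Module.finrank_fin_fun,
    (AdjoinRoot.powerBasis' hmonic).finrank, AdjoinRoot.powerBasis'_dim] at hrank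
  omega

end Generator

/-- The polynomial `X ^ Q - X`, `Q = |F|`, has at most `Q` roots in `K`, and the image of `F`
already supplies them. -/
theorem mem_range_of_pow_card [Finite F] {x : K} (hx : x ^ Nat.card F = x) :
    x ∈ Set.range (algebraMap F K) := by
  classical
  have := Fintype.ofFinite F
  rw [Nat.card_eq_fintype_card] at hx
  have hq : 1 < Fintype.card F := Fintype.one_lt_card
  have hp : (X ^ Fintype.card F - X : K[X]) ≠ 0 := FiniteField.X_pow_card_sub_X_ne_zero K hq
  have hsub : Finset.univ.image (algebraMap F K) ⊆ (X ^ Fintype.card F - X : K[X]).roots.toFinset := by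
    intro y hy
    obtain ⟨a, -, rfl⟩ := Finset.mem_image.1 hy
    rw [Multiset.mem_toFinset, mem_roots hp]
    simp [← map_pow, FiniteField.pow_card]
  have hcard : (X ^ Fintype.card F - X : K[X]).roots.toFinset.card ≤
      (Finset.univ.image (algebraMap F K)).card := by
    rw [Finset.card_image_of_injective _ (algebraMap F K).injective, Finset.card_univ]
    refine (Multiset.toFinset_card_le _).trans ((card_roots' _).trans ?_)
    rw [FiniteField.X_pow_card_sub_X_natDegree_eq K hq]
  have hmem : x ∈ (X ^ Fintype.card F - X : K[X]).roots.toFinset := by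
    rw [Multiset.mem_toFinset, mem_roots hp]
    simp [hx]
  rw [← Finset.eq_of_subset_of_card_le hsub hcard] at hmem
  obtain ⟨a, -, rfl⟩ := Finset.mem_image.1 hmem
  exact ⟨a, rfl⟩

/-- A set of roots that is stable under the Frobenius is the set of roots of a polynomial over the
base field. -/
theorem exists_map_eq_prod [Finite F] (Y : Finset K) (hY : ∀ ρ ∈ Y, ρ ^ Nat.card F ∈ Y) :
    ∃ g : F[X], g.Monic ∧ g.map (algebraMap F K) = ∏ ρ ∈ Y, (X - C ρ) := by
  classical
  have := Fintype.ofFinite F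
  let φ : K →+* K := (FiniteField.frobeniusAlgHom F K).toRingHom
  have hφ : ∀ x, φ x = x ^ Nat.card F := fun x => by
    rw [Nat.card_eq_fintype_card]; rfl
  have himg : Y.image φ = Y := by
    refine Finset.eq_of_subset_of_card_le (fun y hy => ?_) ?_
    · obtain ⟨ρ, hρ, rfl⟩ := Finset.mem_image.1 hy
      rw [hφ]
      exact hY ρ hρ
    · rw [Finset.card_image_of_injective _ φ.injective]
  have hfix : (∏ ρ ∈ Y, (X - C ρ)).map φ = ∏ ρ ∈ Y, (X - C ρ) := by
    rw [Polynomial.map_prod]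
    simp only [Polynomial.map_sub, map_X, map_C]
    conv_rhs => rw [← himg, Finset.prod_image fun a _ b _ h => φ.injective h]
  have hmonic : (∏ ρ ∈ Y, (X - C ρ)).Monic := monic_prod_of_monic _ _ fun ρ _ => monic_X_sub_C ρ
  have hlifts : ∏ ρ ∈ Y, (X - C ρ) ∈ lifts (algebraMap F K) := by
    rw [lifts_iff_coeff_lifts]
    intro i
    refine mem_range_of_pow_card ?_
    rw [← hφ, ← coeff_map, hfix]
  obtain ⟨g, hg, -, hgm⟩ := lifts_and_natDegree_eq_and_monic hlifts hmonic
  exact ⟨g, hgm, hg⟩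

theorem finrank_rootCode [Finite F] {n : ℕ} (Y : Finset K) (hY : ∀ ρ ∈ Y, ρ ^ Nat.card F ∈ Y)
    (hn : Y.card ≤ n) : Module.finrank F (rootCode F n Y) + Y.card = n := by
  obtain ⟨g, hmonic, hg⟩ := exists_map_eq_prod Y hY
  rw [← natDegree_of_map_eq hg] at hn ⊢
  exact finrank_of_generator hmonic hn fun c => by rw [dvd_iff_of_map_eq hg, mem_rootCode]

/-- A constacyclic code is determined by the roots of its generator polynomial. -/
theorem eq_rootCode_of_isGeneratorPoly [Finite F] [DecidableEq K] {n : ℕ} {α : F}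
    {C : Submodule F (Fin n → F)} {g : F[X]} (hg : IsGeneratorPoly α C g) {Ω Y : Finset K}
    (hΩ : ∀ ρ ∈ Ω, ρ ^ n = algebraMap F K α) (hcard : Ω.card = n) (hYΩ : Y ⊆ Ω)
    (hY : ∀ ρ ∈ Ω, aeval ρ g = 0 ↔ ρ ∈ Y) : C = rootCode F n Y := by
  obtain ⟨hmonic, ⟨h, hgh⟩, hC⟩ := hg
  rcases Nat.eq_zero_or_pos n with rfl | hn
  · exact Subsingleton.elim _ _
  have hXn : (X ^ n - Polynomial.C α : F[X]) ≠ 0 := X_pow_sub_C_ne_zero hn α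
  have hg0 : g ≠ 0 := hmonic.ne_zero
  have hh0 : h ≠ 0 := by
    rintro rfl
    rw [mul_zero] at hgh
    exact hXn hgh
  -- The cofactor `h` must vanish on `Ω \ Y`, which bounds its degree below and so that of `g` above
  -- by `Y.card`.
  have hsdiff : (Ω \ Y).card ≤ h.natDegree := by
    have h1 : ∏ ρ ∈ Ω \ Y, (X - Polynomial.C ρ) ∣ h.map (algebraMap F K) := by
      rw [prod_X_sub_C_dvd_map_iff]
      intro ρ hρ
      rw [Finset.mem_sdiff] at hρ
      have h2 : aeval ρ g * aeval ρ h = 0 := by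
        rw [← map_mul, ← hgh]
        simp [hΩ ρ hρ.1]
      exact (mul_eq_zero.1 h2).resolve_left fun h3 => hρ.2 ((hY ρ hρ.1).1 h3)
    have h2 := natDegree_le_of_dvd h1 ((Polynomial.map_ne_zero_iff (algebraMap F K).injective).2 hh0)
    rw [natDegree_map, natDegree_prod_of_monic _ _ fun ρ _ => monic_X_sub_C ρ] at h2
    simpa using h2
  have hdeg : g.natDegree + h.natDegree = n := by
    rw [← natDegree_mul hg0 hh0, ← hgh, natDegree_X_pow_sub_C]
  have hle : g.natDegree ≤ Y.card := by
    rw [Finset.card_sdiff_of_subset hYΩ, hcard] at hsdiff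
    omega
  have hprod : g.map (algebraMap F K) = ∏ ρ ∈ Y, (X - Polynomial.C ρ) := by
    refine eq_of_monic_of_dvd_of_natDegree_le (monic_prod_of_monic _ _ fun ρ _ => monic_X_sub_C ρ)
      (hmonic.map _) ?_ ?_
    · rw [prod_X_sub_C_dvd_map_iff]
      exact fun ρ hρ => (hY ρ (hYΩ hρ)).2 hρ
    · rw [natDegree_map, natDegree_prod_of_monic _ _ fun ρ _ => monic_X_sub_C ρ]
      simpa using hle
  ext c
  rw [hC, dvd_iff_of_map_eq hprod, mem_rootCode]

/-- The BCH bound: a word whose polynomial vanishes at `w` consecutive powers has more than `w`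
nonzero coordinates. -/
theorem lt_hammingNorm_of_roots [DecidableEq F] {n w : ℕ} {θ γ : K} (hθ : IsPrimitiveRoot θ n)
    (hγ : γ ≠ 0) {c : Fin n → F} (hc : c ≠ 0)
    (hroot : ∀ u < w, aeval (γ * θ ^ u) (wordPoly c) = 0) : w < hammingNorm c := by
  by_contra hle
  push Not at hle
  obtain ⟨i₀, hi₀⟩ := Function.ne_iff.mp hc
  set S : Finset (Fin n) := {i | c i ≠ 0} with hS
  have hi₀S : i₀ ∈ S := by simpa [hS] using hi₀
  have hScard : S.card ≤ w := hle
  let a : Fin n → K := fun i => algebraMap F K (c i) * γ ^ (i : ℕ)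
  have hpow : ∀ u < w, ∑ i, a i * (θ ^ (i : ℕ)) ^ u = 0 := by
    intro u hu
    rw [← hroot u hu, aeval_wordPoly]
    refine Finset.sum_congr rfl fun i _ => ?_
    simp only [a]
    rw [mul_pow, ← pow_mul, ← pow_mul, mul_comm u, mul_assoc]
  have hpoly : ∀ p : K[X], p.natDegree < w → ∑ i, a i * p.eval (θ ^ (i : ℕ)) = 0 := by
    intro p hp
    simp only [eval_eq_sum_range' hp, Finset.mul_sum]
    rw [Finset.sum_comm]
    refine Finset.sum_eq_zero fun u hu => ?_
    simp only [mul_left_comm _ (p.coeff u), ← Finset.mul_sum]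
    rw [hpow u (Finset.mem_range.1 hu), mul_zero]
  have hcard : (S.erase i₀).card < S.card := Finset.card_erase_lt_of_mem hi₀S
  -- The test polynomial vanishes at all support positions except `i₀`, and its degree `S.card - 1`
  -- is below `w`; only the nonzero term at `i₀` survives.
  have h1 := hpoly (∏ j ∈ S.erase i₀, (X - C (θ ^ (j : ℕ)))) (by
    rw [natDegree_prod_of_monic _ _ fun j _ => monic_X_sub_C _]
    simp only [natDegree_X_sub_C, Finset.sum_const, smul_eq_mul, mul_one]
    omega)
  rw [Finset.sum_eq_single i₀] at h1
  · rw [eval_prod] at h1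
    have hinj : ∀ j : Fin n, θ ^ (i₀ : ℕ) = θ ^ (j : ℕ) → i₀ = j := fun j h =>
      Fin.ext (hθ.pow_inj i₀.2 j.2 h)
    refine mul_ne_zero (mul_ne_zero ?_ (pow_ne_zero _ hγ)) ?_ h1
    · rw [Ne, FaithfulSMul.algebraMap_eq_zero_iff]
      exact hi₀
    · rw [Finset.prod_ne_zero_iff]
      intro j hj
      rw [eval_sub, eval_X, eval_C, sub_ne_zero]
      exact fun h => (Finset.mem_erase.1 hj).1 (hinj j h).symm
  · intro i _ hi
    by_cases hiS : i ∈ S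
    · rw [eval_prod, Finset.prod_eq_zero (Finset.mem_erase.2 ⟨hi, hiS⟩), mul_zero]
      simp
    · have : c i = 0 := by simpa [hS] using hiS
      simp [a, this]
  · simp

end RootCode

/-! ### Minimum weight words of MDS codes. -/

section MDS

variable {F : Type*} [Field F]

/-- Vanishing off `S` imposes `n - w - 1` conditions on a space of dimension `n - w`. -/
theorem exists_mem_support_subset {n w : ℕ} {C : Submodule F (Fin n → F)}
    (hdim : Module.finrank F C + w = n) (S : Finset (Fin n)) (hS : S.card = w + 1) :
    ∃ c ∈ C, c ≠ 0 ∧ ∀ i, i ∉ S → c i = 0 := by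
  let f : C →ₗ[F] ({i // i ∉ S} → F) :=
    (LinearMap.pi fun i : {i // i ∉ S} => LinearMap.proj (i : Fin n)).domRestrict C
  have hcard : Fintype.card {i // i ∉ S} = n - (w + 1) := by
    rw [Fintype.card_subtype_compl, Fintype.card_fin, Fintype.card_coe, hS]
  have hle : w + 1 ≤ n := by simpa [hS] using S.card_le_univ
  have hker : LinearMap.ker f ≠ ⊥ := f.ker_ne_bot_of_finrank_lt (by
    rw [Module.finrank_fintype_fun_eq_card, hcard]
    omega)
  obtain ⟨c, hc, hc0⟩ := Submodule.exists_mem_ne_zero_of_ne_bot hker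
  refine ⟨c, c.2, fun h => hc0 (Subtype.ext h), fun i hi => ?_⟩
  exact congrFun (LinearMap.mem_ker.1 hc) ⟨i, hi⟩

/-- The words of minimum weight of a maximum distance separable code span it. -/
theorem exists_min_weight_not_mem [DecidableEq F] {n w : ℕ} {C D : Submodule F (Fin n → F)}
    (hdim : Module.finrank F C + w = n) (hmin : ∀ c ∈ C, c ≠ 0 → w < hammingNorm c)
    (hCD : ¬ C ≤ D) : ∃ c ∈ C, c ∉ D ∧ hammingNorm c = w + 1 := by
  classical
  have hex : ∃ v, ∃ c ∈ C, c ∉ D ∧ hammingNorm c = v := by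
    obtain ⟨c, hc, hcD⟩ := Set.not_subset.1 hCD
    exact ⟨_, c, hc, hcD, rfl⟩
  -- Take a word outside `D` of least weight. If it is heavier than `w + 1`, its support contains
  -- that of a word `b` of weight `w + 1`. Should `b` lie in `D`, cancelling a coordinate of `c`
  -- with it yields a lighter word outside `D`.
  obtain ⟨c, hc, hcD, hcv⟩ := Nat.find_spec hex
  have hc0 : c ≠ 0 := fun h => hcD (h ▸ D.zero_mem)
  have hlt := hmin c hc hc0
  rcases Nat.eq_or_lt_of_le hlt with heq | hlt'
  · exact ⟨c, hc, hcD, heq.symm⟩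
  obtain ⟨S, hSsub, hScard⟩ := Finset.exists_subset_card_eq
    (s := ({i | c i ≠ 0} : Finset (Fin n))) (n := w + 1) hlt
  obtain ⟨b, hb, hb0, hbS⟩ := exists_mem_support_subset hdim S hScard
  obtain ⟨i, hi⟩ := Function.ne_iff.mp hb0
  have hbsub : ({i | b i ≠ 0} : Finset (Fin n)) ⊆ S := by
    intro j hj
    by_contra hjS
    exact (Finset.mem_filter.1 hj).2 (hbS j hjS)
  have hbw : hammingNorm b = w + 1 :=
    le_antisymm ((Finset.card_le_card hbsub).trans hScard.le) (hmin b hb hb0)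
  by_cases hbD : b ∈ D
  · exfalso
    set c' := c - (c i / b i) • b with hc'
    have hc'D : c' ∉ D := fun h => hcD (by
      have := D.add_mem h (D.smul_mem (c i / b i) hbD)
      rwa [hc', sub_add_cancel] at this)
    refine Nat.find_min hex (m := hammingNorm c') ?_
      ⟨c', C.sub_mem hc (C.smul_mem _ hb), hc'D, rfl⟩
    rw [← hcv]
    have hiS : i ∈ S := hbsub (by simpa using hi)
    refine Finset.card_lt_card ⟨fun j hj => ?_, fun h => ?_⟩
    · by_contra hjc
      have hjc0 : c j = 0 := by simpa using hjc
      have hjb : b j = 0 := hbS j fun hjS => hjc (hSsub hjS)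
      exact (Finset.mem_filter.1 hj).2 (by simp [hc', hjc0, hjb])
    · have := h (hSsub hiS)
      refine (Finset.mem_filter.1 this).2 ?_
      have hi' : b i ≠ 0 := hi
      simp [hc', div_mul_cancel₀ _ hi']
  · exact ⟨b, hb, hbD, hbw⟩

end MDS

/-! ### From Hermitian dual codes to quantum parameters and the rank of `H H*`. -/

section HermitianConstruction

variable {F : Type*} [Field F] [Finite F] {n e : ℕ} {C D : Submodule F (Fin n → F)}

theorem charP_two_of_card (hF : Nat.card F = (2 ^ e) ^ 2) : CharP F 2 := by
  have := Fintype.ofFinite F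
  rw [← pow_mul, Nat.card_eq_fintype_card] at hF
  exact charP_of_card_eq_prime_pow hF

/-- The conjugate of `∑ cᵢ dᵢ ^ q` is `∑ dᵢ cᵢ ^ q`. -/
theorem hermitian_symm (hF : Nat.card F = (2 ^ e) ^ 2) {c d : Fin n → F}
    (h : ∑ i, c i * d i ^ 2 ^ e = 0) : ∑ i, d i * c i ^ 2 ^ e = 0 := by
  have := charP_two_of_card hF
  have h1 := congrArg (· ^ 2 ^ e) h
  simp only [sum_pow_char_pow, mul_pow, pow_card_eq_self hF] at h1
  rw [zero_pow (by positivity)] at h1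
  rw [← h1]
  exact Finset.sum_congr rfl fun i _ => mul_comm _ _

/-- The Hermitian construction of entanglement-assisted quantum codes. -/
theorem existsEAQEC_of_hermitian [DecidableEq F] {k c d : ℕ} (hF : Nat.card F = (2 ^ e) ^ 2)
    (hdim : Module.finrank F C + Module.finrank F D = n)
    (horth : ∀ c ∈ C, ∀ d ∈ D, ∑ i, c i * d i ^ 2 ^ e = 0)
    (hk : Module.finrank F C = Module.finrank F (C ⊓ D : Submodule F (Fin n → F)) + k)
    (hc : Module.finrank F D = Module.finrank F (C ⊓ D : Submodule F (Fin n → F)) + c)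
    (hmin : ∀ u ∈ C, u ≠ 0 → d ≤ hammingNorm u) (hd : ∃ u ∈ C, u ∉ D ∧ hammingNorm u = d) :
    ExistsEAQEC (2 ^ e) n k d c := by
  have := charP_two_of_card hF
  let _ : Algebra (ZMod 2) F := ZMod.algebra F 2
  have := Fintype.ofFinite F
  obtain ⟨p, hp⟩ := exists_isErrorBasis (hermForm_isAlt hF) (hermForm_nondegenerate hF)
    (finrank_zmod_two hF)
  have hfin : ∀ W : Submodule F (Fin n → F), Module.finrank (ZMod 2) (W.restrictScalars (ZMod 2)) =
      2 * e * Module.finrank F W := by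
    intro W
    rw [← finrank_zmod_two hF]
    exact (Module.finrank_mul_finrank (ZMod 2) F W).symm
  have hinf : C.restrictScalars (ZMod 2) ⊓ D.restrictScalars (ZMod 2) =
      (C ⊓ D).restrictScalars (ZMod 2) := rfl
  refine existsEAQEC_of_orthogonal rfl (hermForm_isAlt hF) hp
    (by rw [← Nat.card_eq_fintype_card, hF]) (C.restrictScalars (ZMod 2))
    (D.restrictScalars (ZMod 2)) (orthogonal_eq_of_hermitian hF C D hdim horth)
    (orthogonal_eq_of_hermitian hF D C (by rw [add_comm, hdim])
      fun d hd c hc => hermitian_symm hF (horth c hc d hd)) ?_ ?_ hmin hd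
  · rw [hinf, hfin, hfin, hk]
    ring
  · rw [hinf, hfin, hfin, hc]
    ring

/-- The rank of `H H^*` is the codimension of the hull in the Hermitian dual. -/
theorem rank_mul_hermTranspose (hF : Nat.card F = (2 ^ e) ^ 2)
    (hdim : Module.finrank F C + Module.finrank F D = n)
    (horth : ∀ c ∈ C, ∀ d ∈ D, ∑ i, c i * d i ^ 2 ^ e = 0) {m : ℕ} {H : Matrix (Fin m) (Fin n) F}
    (hH : IsParityCheck C H) : (H * hermTranspose (2 ^ e) H).rank +
      Module.finrank F (C ⊓ D : Submodule F (Fin n → F)) = Module.finrank F D := by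
  have := charP_two_of_card hF
  let _ : Algebra (ZMod 2) F := ZMod.algebra F 2
  obtain ⟨hind, hker⟩ := hH
  have hkerC : LinearMap.ker H.mulVecLin = C := by
    ext c
    rw [LinearMap.mem_ker, Matrix.mulVecLin_apply, hker]
  have hm : Module.finrank F D = m := by
    have h1 := LinearMap.finrank_range_add_finrank_ker H.mulVecLin
    rw [hkerC, Module.finrank_fin_fun] at h1
    have h2 : H.rank = m := by simpa using LinearIndependent.rank_matrix hind
    rw [Matrix.rank] at h2
    omega
  set G := (hermTranspose (2 ^ e) H).mulVecLin with hG
  have hGapp : ∀ y j, G y j = ∑ i, H i j ^ 2 ^ e * y i := fun y j => rfl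
  have hpow : ∀ y j, G y j ^ 2 ^ e = ∑ i, y i ^ 2 ^ e * H i j := by
    intro y j
    rw [hGapp, sum_pow_char_pow]
    refine Finset.sum_congr rfl fun i _ => ?_
    rw [mul_pow, pow_card_eq_self hF, mul_comm]
  have hGinj : Function.Injective G := by
    rw [← LinearMap.ker_eq_bot, LinearMap.ker_eq_bot']
    intro y hy
    have h1 : ∑ i, y i ^ 2 ^ e • H.row i = 0 := by
      funext j
      have := hpow y j
      rw [hy, Pi.zero_apply, zero_pow (by positivity)] at this
      simpa [Matrix.row] using this.symm
    funext i
    exact eq_zero_of_pow_eq_zero (Fintype.linearIndependent_iff.1 hind _ h1 i)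
  -- `H*` maps isomorphically onto `D`, so `rank (H H*)` is the dimension of the image of `D` under
  -- `H`, whose kernel there is `C ⊓ D`.
  have hrange : LinearMap.range G = D := by
    refine Submodule.eq_of_le_of_finrank_eq ?_ ?_
    · rintro _ ⟨y, rfl⟩
      have h1 := orthogonal_eq_of_hermitian hF C D hdim horth
      change G y ∈ D.restrictScalars (ZMod 2)
      rw [h1]
      intro c hc
      change piForm (Fin n) (hermForm F e) c (G y) = 0
      rw [piForm_apply]
      simp only [hermForm_apply]
      rw [← map_sum]
      have h2 : ∑ j, c j * G y j ^ 2 ^ e = 0 := by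
        have h3 := (hker c).1 hc
        simp only [hpow, Finset.mul_sum]
        rw [Finset.sum_comm]
        refine Finset.sum_eq_zero fun i _ => ?_
        have h4 := congrFun h3 i
        rw [Matrix.mulVec, dotProduct, Pi.zero_apply] at h4
        calc ∑ j, c j * (y i ^ 2 ^ e * H i j) = y i ^ 2 ^ e * ∑ j, H i j * c j := by
              rw [Finset.mul_sum]
              exact Finset.sum_congr rfl fun j _ => by ring
          _ = 0 := by rw [h4, mul_zero]
      rw [h2, map_zero]
    · rw [LinearMap.finrank_range_of_inj hGinj, hm, Module.finrank_fin_fun]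
  have h1 := LinearMap.finrank_range_add_finrank_ker (H.mulVecLin.domRestrict D)
  rw [LinearMap.range_domRestrict, LinearMap.ker_domRestrict, hkerC] at h1
  rw [Matrix.rank, Matrix.mulVecLin_mul, LinearMap.range_comp, ← hG, hrange, ← h1,
    ← Submodule.finrank_map_subtype_eq D, Submodule.map_comap_subtype, inf_comm]

end HermitianConstruction

/-! ### The Hermitian dual of a root code. -/

section Duality

open Polynomial

variable {F K : Type*} [Field F] [Finite F] [Field K] [Algebra F K] [DecidableEq K]
  {n e : ℕ} {α : F} {Ω Y : Finset K}

/-- The roots of `x ^ n - α` whose conjugate inverse is not in `Y`. -/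
def dualRoots (q : ℕ) (Ω Y : Finset K) : Finset K := {ρ ∈ Ω | (ρ ^ q)⁻¹ ∉ Y}

theorem charP_two_of_algebra (F K : Type*) [Field F] [Field K] [Algebra F K] [CharP F 2] :
    CharP K 2 :=
  charP_of_injective_algebraMap (algebraMap F K).injective 2

theorem pow_two_pow_injective {K : Type*} [Field K] [CharP K 2] (e : ℕ) : Function.Injective fun x : K => x ^ 2 ^ e :=
  iterateFrobenius_inj K 2 e

/-- Multiplication by `θ` permutes the roots and multiplies the sum by `θ ^ (q (j - i)) ≠ 1`. -/
theorem sum_roots_eq_zero {K : Type*} [Field K] {Ω : Finset K} {n : ℕ} {θ a : K}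
    (hΩ : ∀ ρ, ρ ∈ Ω ↔ ρ ^ n = a) (hn : n ≠ 0)
    (hθ : IsPrimitiveRoot θ n) {q : ℕ} (hq : q.Coprime n) {i j : ℕ} (hi : i < n) (hj : j < n)
    (hij : i ≠ j) : ∑ ρ ∈ Ω, ((ρ ^ q)⁻¹) ^ i * (ρ ^ j) ^ q = 0 := by
  have hθ0 : θ ≠ 0 := hθ.ne_zero hn
  have hη : IsPrimitiveRoot (θ ^ q) n := hθ.pow_of_coprime q hq
  set η := θ ^ q with hη'
  have hη0 : η ≠ 0 := hη.ne_zero hn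
  set S := ∑ ρ ∈ Ω, ((ρ ^ q)⁻¹) ^ i * (ρ ^ j) ^ q with hS
  have hshift : S = (η⁻¹ ^ i * η ^ j) * S := by
    conv_rhs => rw [hS, Finset.mul_sum]
    refine Finset.sum_nbij' (fun ρ => θ⁻¹ * ρ) (fun ρ => θ * ρ) ?_ ?_ ?_ ?_ ?_
    · intro ρ hρ
      rw [hΩ] at hρ ⊢
      rw [mul_pow, inv_pow, hθ.pow_eq_one, inv_one, one_mul, hρ]
    · intro ρ hρ
      rw [hΩ] at hρ ⊢
      rw [mul_pow, hθ.pow_eq_one, one_mul, hρ]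
    · intro ρ _
      rw [mul_inv_cancel_left₀ hθ0]
    · intro ρ _
      rw [inv_mul_cancel_left₀ hθ0]
    · intro ρ _
      obtain ⟨σ, rfl⟩ : ∃ σ, ρ = θ * σ := ⟨θ⁻¹ * ρ, by rw [mul_inv_cancel_left₀ hθ0]⟩
      rw [inv_mul_cancel_left₀ hθ0, hη']
      simp only [mul_pow, mul_inv, inv_pow, ← pow_mul]
      ring
  have hne : η⁻¹ ^ i * η ^ j ≠ 1 := by
    intro h
    rw [inv_pow, inv_mul_eq_one₀ (pow_ne_zero _ hη0)] at h
    exact hij (hη.pow_inj hi hj h)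
  have h1 : (η⁻¹ ^ i * η ^ j - 1) * S = 0 := by linear_combination -hshift
  exact (mul_eq_zero.1 h1).resolve_left (sub_ne_zero.2 hne)

/-- A Parseval identity: the sum over `ρ ∈ Ω` of `c(ρ ^ (-q)) d(ρ) ^ q` equals `n ∑ cᵢ dᵢ ^ q`.
Every term vanishes by the choice of `dualRoots`, and `n` is odd, hence invertible. -/
theorem hermitian_orthogonal_dualRoots (hF : Nat.card F = (2 ^ e) ^ 2) {θ : K}
    (hΩ : ∀ ρ, ρ ∈ Ω ↔ ρ ^ n = algebraMap F K α) (hα : α ≠ 0) (hcard : Ω.card = n) (hn : Odd n)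
    (hθ : IsPrimitiveRoot θ n) {c d : Fin n → F}
    (hc : c ∈ rootCode F n Y) (hd : d ∈ rootCode F n (dualRoots (2 ^ e) Ω Y)) :
    ∑ i, c i * d i ^ 2 ^ e = 0 := by
  have := charP_two_of_card hF
  have := charP_two_of_algebra F K
  have hn0 : n ≠ 0 := hn.pos.ne'
  have ha : algebraMap F K α ≠ 0 := by rwa [Ne, FaithfulSMul.algebraMap_eq_zero_iff]
  have hzero : ∑ ρ ∈ Ω, aeval ((ρ ^ 2 ^ e)⁻¹) (wordPoly c) * (aeval ρ (wordPoly d)) ^ 2 ^ e = 0 := by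
    refine Finset.sum_eq_zero fun ρ hρ => ?_
    by_cases h : (ρ ^ 2 ^ e)⁻¹ ∈ Y
    · rw [hc _ h, zero_mul]
    · rw [hd ρ (Finset.mem_filter.2 ⟨hρ, h⟩), zero_pow (by positivity), mul_zero]
  have hterm : ∀ ρ, aeval ((ρ ^ 2 ^ e)⁻¹) (wordPoly c) * (aeval ρ (wordPoly d)) ^ 2 ^ e =
      ∑ i : Fin n, ∑ j : Fin n, algebraMap F K (c i * d j ^ 2 ^ e) *
        (((ρ ^ 2 ^ e)⁻¹) ^ (i : ℕ) * (ρ ^ (j : ℕ)) ^ 2 ^ e) := by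
    intro ρ
    rw [aeval_wordPoly, aeval_wordPoly, sum_pow_char_pow, Finset.sum_mul_sum]
    refine Finset.sum_congr rfl fun i _ => Finset.sum_congr rfl fun j _ => ?_
    rw [map_mul, map_pow, mul_pow]
    ring
  simp only [hterm] at hzero
  rw [Finset.sum_comm] at hzero
  have hinner : ∀ i : Fin n, ∑ ρ ∈ Ω, ∑ j : Fin n, algebraMap F K (c i * d j ^ 2 ^ e) *
        (((ρ ^ 2 ^ e)⁻¹) ^ (i : ℕ) * (ρ ^ (j : ℕ)) ^ 2 ^ e) =
      (n : K) * algebraMap F K (c i * d i ^ 2 ^ e) := by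
    intro i
    rw [Finset.sum_comm, Finset.sum_eq_single i]
    · rw [← Finset.mul_sum, mul_comm]
      congr 1
      have hone : ∀ ρ ∈ Ω, ((ρ ^ 2 ^ e)⁻¹) ^ (i : ℕ) * (ρ ^ (i : ℕ)) ^ 2 ^ e = 1 := by
        intro ρ hρ
        have hρ0 : ρ ≠ 0 := by
          rintro rfl
          rw [hΩ, zero_pow hn0] at hρ
          exact ha hρ.symm
        rw [inv_pow, ← pow_mul, ← pow_mul, mul_comm, mul_comm (i : ℕ), mul_inv_cancel₀]
        exact pow_ne_zero _ hρ0
      rw [Finset.sum_congr rfl hone, Finset.sum_const, hcard, nsmul_eq_mul, mul_one]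
    · intro j _ hj
      rw [← Finset.mul_sum, sum_roots_eq_zero hΩ hn0 hθ
        (Nat.Coprime.pow_left e (Nat.coprime_two_left.2 hn)) i.2 j.2
        fun h => hj (Fin.ext h.symm), mul_zero]
    · simp
  simp only [hinner] at hzero
  rw [← Finset.mul_sum, ← map_sum] at hzero
  have hnK : (n : K) ≠ 0 := by
    rw [Ne, CharP.cast_eq_zero_iff K 2]
    exact hn.not_two_dvd_nat
  exact (FaithfulSMul.algebraMap_eq_zero_iff F K).1 ((mul_eq_zero.1 hzero).resolve_left hnK)

/-- An injective self-map of a finite set is onto, so stability also holds backwards. -/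
theorem mem_of_pow_mem {K : Type*} [Field K] [DecidableEq K] [CharP K 2] {Y : Finset K} {m : ℕ}
    (hY : ∀ ρ ∈ Y, ρ ^ 2 ^ m ∈ Y) {ρ : K} (hρ : ρ ^ 2 ^ m ∈ Y) : ρ ∈ Y := by
  have himg : Y.image (fun x => x ^ 2 ^ m) = Y := by
    refine Finset.eq_of_subset_of_card_le (Finset.image_subset_iff.2 hY) ?_
    rw [Finset.card_image_of_injective _ (pow_two_pow_injective m)]
  rw [← himg] at hρ
  obtain ⟨y, hy, h⟩ := Finset.mem_image.1 hρ
  rwa [← pow_two_pow_injective m h]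

theorem dualRoots_stable (hF : Nat.card F = (2 ^ e) ^ 2)
    (hΩ : ∀ ρ, ρ ∈ Ω ↔ ρ ^ n = algebraMap F K α) (hY : ∀ ρ ∈ Y, ρ ^ Nat.card F ∈ Y) :
    ∀ ρ ∈ dualRoots (2 ^ e) Ω Y, ρ ^ Nat.card F ∈ dualRoots (2 ^ e) Ω Y := by
  have := charP_two_of_card hF
  have := charP_two_of_algebra F K
  intro ρ hρ
  rw [dualRoots, Finset.mem_filter, hΩ] at hρ ⊢
  refine ⟨?_, fun h => hρ.2 ?_⟩
  · have := Fintype.ofFinite F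
    rw [← pow_mul, mul_comm, pow_mul, hρ.1, ← map_pow, Nat.card_eq_fintype_card,
      FiniteField.pow_card]
  · rw [← pow_mul, mul_comm, pow_mul, ← inv_pow] at h
    rw [hF, ← pow_mul] at h hY
    exact mem_of_pow_mem hY h

/-- As `α ^ (-q) = α`, the map `ρ ↦ ρ ^ (-q)` permutes the roots of `xⁿ - α`. -/
theorem card_filter_conj_inv_mem (hF : Nat.card F = (2 ^ e) ^ 2)
    (hΩ : ∀ ρ, ρ ∈ Ω ↔ ρ ^ n = algebraMap F K α) (hα : α ^ (2 ^ e + 1) = 1) (hYΩ : Y ⊆ Ω) :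
    ({ρ ∈ Ω | (ρ ^ 2 ^ e)⁻¹ ∈ Y} : Finset K).card = Y.card := by
  have := charP_two_of_card hF
  have := charP_two_of_algebra F K
  have hinj : Function.Injective fun ρ : K => (ρ ^ 2 ^ e)⁻¹ :=
    inv_injective.comp (pow_two_pow_injective e)
  have himg : Ω.image (fun ρ => (ρ ^ 2 ^ e)⁻¹) = Ω := by
    refine Finset.eq_of_subset_of_card_le (Finset.image_subset_iff.2 fun ρ hρ => ?_) ?_
    · rw [hΩ] at hρ ⊢
      rw [inv_pow, ← pow_mul, mul_comm, pow_mul, hρ]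
      refine inv_eq_of_mul_eq_one_right ?_
      rw [← map_pow, ← map_mul, ← pow_succ, hα, map_one]
    · rw [Finset.card_image_of_injective _ hinj]
  rw [← Finset.card_image_of_injective _ hinj]
  congr 1
  ext σ
  simp only [Finset.mem_image, Finset.mem_filter]
  constructor
  · rintro ⟨ρ, ⟨-, h⟩, rfl⟩
    exact h
  · intro hσ
    have := hYΩ hσ
    rw [← himg] at this
    obtain ⟨ρ, hρ, rfl⟩ := Finset.mem_image.1 this
    exact ⟨ρ, ⟨hρ, hσ⟩, rfl⟩

theorem finrank_rootCode_dualRoots (hF : Nat.card F = (2 ^ e) ^ 2)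
    (hΩ : ∀ ρ, ρ ∈ Ω ↔ ρ ^ n = algebraMap F K α) (hα : α ^ (2 ^ e + 1) = 1) (hcard : Ω.card = n)
    (hYΩ : Y ⊆ Ω) (hY : ∀ ρ ∈ Y, ρ ^ Nat.card F ∈ Y) :
    Module.finrank F (rootCode F n (dualRoots (2 ^ e) Ω Y)) = Y.card := by
  have h1 := Finset.card_filter_add_card_filter_not (s := Ω) fun ρ => (ρ ^ 2 ^ e)⁻¹ ∈ Y
  rw [card_filter_conj_inv_mem hF hΩ hα hYΩ, hcard] at h1
  have h2 := finrank_rootCode (F := F) (n := n) _ (dualRoots_stable hF hΩ hY) (by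
    rw [← hcard]; exact Finset.card_filter_le _ _)
  rw [dualRoots] at h2 ⊢
  omega

/-- The hull is again a root code, and the roots missing from it are the `ρ ∉ Y` with `ρ ^ (-q) ∈
Y`. The defect is the set whose size becomes the number of shared pairs. -/
theorem finrank_rootCode_inf_dualRoots (hF : Nat.card F = (2 ^ e) ^ 2)
    (hΩ : ∀ ρ, ρ ∈ Ω ↔ ρ ^ n = algebraMap F K α) (hα : α ^ (2 ^ e + 1) = 1) (hcard : Ω.card = n)
    (hYΩ : Y ⊆ Ω) (hY : ∀ ρ ∈ Y, ρ ^ Nat.card F ∈ Y) :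
    Module.finrank F (rootCode F n Y ⊓ rootCode F n (dualRoots (2 ^ e) Ω Y) :
      Submodule F (Fin n → F)) + ({ρ ∈ Y | (ρ ^ 2 ^ e)⁻¹ ∈ Y} : Finset K).card = Y.card := by
  have hinf : rootCode F n Y ⊓ rootCode F n (dualRoots (2 ^ e) Ω Y) =
      rootCode F n (Y ∪ dualRoots (2 ^ e) Ω Y) := by
    ext c
    simp only [Submodule.mem_inf, mem_rootCode, Finset.mem_union, or_imp, forall_and]
  have hsub : Y ∪ dualRoots (2 ^ e) Ω Y ⊆ Ω :=
    Finset.union_subset hYΩ (Finset.filter_subset _ _)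
  have h1 := finrank_rootCode (F := F) (n := n) (Y ∪ dualRoots (2 ^ e) Ω Y)
    (fun ρ hρ => by
      rw [Finset.mem_union] at hρ ⊢
      exact hρ.imp (hY ρ) (dualRoots_stable hF hΩ hY ρ))
    (by rw [← hcard]; exact Finset.card_le_card hsub)
  have h2 := Finset.card_sdiff_add_card_eq_card hsub
  have h3 : Ω \ (Y ∪ dualRoots (2 ^ e) Ω Y) =
      ({ρ ∈ Ω | (ρ ^ 2 ^ e)⁻¹ ∈ Y} : Finset K) \ ({ρ ∈ Y | (ρ ^ 2 ^ e)⁻¹ ∈ Y} : Finset K) := by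
    ext ρ
    simp only [dualRoots, Finset.mem_sdiff, Finset.mem_union, Finset.mem_filter]
    tauto
  have h4 : ({ρ ∈ Y | (ρ ^ 2 ^ e)⁻¹ ∈ Y} : Finset K) ⊆ {ρ ∈ Ω | (ρ ^ 2 ^ e)⁻¹ ∈ Y} :=
    Finset.filter_subset_filter _ hYΩ
  have h5 := Finset.card_sdiff_add_card_eq_card h4
  rw [card_filter_conj_inv_mem hF hΩ hα hYΩ, ← h3] at h5
  rw [hinf]
  omega

end Duality

/-! ### The congruence that yields four entangled pairs. -/

section Arithmetic

/-- The only solutions of `s + q t + t' ≡ 0` modulo `n` in the range at hand. -/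
theorem mem_of_dvd_add {a t t' : ℤ} (ha : 0 ≤ a)
    (ht : -(5 * a + 3) ≤ t ∧ t ≤ 5 * a + 4) (ht' : -(5 * a + 3) ≤ t' ∧ t' ≤ 5 * a + 4)
    (h : 20 * a ^ 2 + 32 * a + 13 ∣ (5 * a + 4) * (10 * a + 7) + (10 * a + 8) * t + t') :
    t = a + 1 ∨ t = -a ∨ t = 3 * a + 3 ∨ t = -3 * a - 2 := by
  obtain ⟨k, hk⟩ := h
  obtain ⟨h1, h2⟩ := ht
  obtain ⟨h3, h4⟩ := ht'
  -- The ranges of `t` and `t'` keep `s + q t + t'` between `1` and `5n - 1`. For each of the four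
  -- multiples of `n` left, the equation reads `q (t - t₀) =` a quantity smaller than `q` in
  -- absolute value, so `t = t₀`.
  have hk0 : 1 ≤ k := by nlinarith
  have hk5 : k ≤ 4 := by nlinarith
  obtain rfl | rfl | rfl | rfl : k = 1 ∨ k = 2 ∨ k = 3 ∨ k = 4 := by omega
  · have h5 : (10 * a + 8) * (t + 3 * a + 2) = -t' + a + 1 := by linear_combination hk
    have h6 : t + 3 * a + 2 < 1 := by nlinarith
    have h7 : -1 < t + 3 * a + 2 := by nlinarith
    right; right; right; omega
  · have h5 : (10 * a + 8) * (t + a) = -t' - 3 * a - 2 := by linear_combination hk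
    have h6 : t + a < 1 := by nlinarith
    have h7 : -1 < t + a := by nlinarith
    right; left; omega
  · have h5 : (10 * a + 8) * (t - a - 1) = -t' + 3 * a + 3 := by linear_combination hk
    have h6 : t - a - 1 < 1 := by nlinarith
    have h7 : -1 < t - a - 1 := by nlinarith
    left; omega
  · have h5 : (10 * a + 8) * (t - 3 * a - 3) = -t' - a := by linear_combination hk
    have h6 : t - 3 * a - 3 < 1 := by nlinarith
    have h7 : -1 < t - 3 * a - 3 := by nlinarith
    right; right; left; omega

/-- The exponents counted in the previous lemma. -/
def hullExponents (a : ℤ) : Finset ℤ := {a + 1, -a, 3 * a + 3, -3 * a - 2}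

theorem card_hullExponents {a : ℤ} (ha : 0 ≤ a) : (hullExponents a).card = 4 := by
  rw [hullExponents, Finset.card_insert_of_notMem, Finset.card_insert_of_notMem,
    Finset.card_insert_of_notMem, Finset.card_singleton] <;>
  simp only [Finset.mem_insert, Finset.mem_singleton] <;> omega

/-- The map `ρ ↦ ρ ^ (-q)` runs through the four exponents in the cycle `a + 1`, `3a + 3`, `-a`,
`-3a - 2`. -/
theorem exists_dvd_add_of_mem {a t : ℤ} (ht : t ∈ hullExponents a) : ∃ t' ∈ hullExponents a,
    20 * a ^ 2 + 32 * a + 13 ∣ (5 * a + 4) * (10 * a + 7) + (10 * a + 8) * t + t' := by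
  simp only [hullExponents, Finset.mem_insert, Finset.mem_singleton] at ht ⊢
  rcases ht with rfl | rfl | rfl | rfl
  · exact ⟨3 * a + 3, by simp, 3, by ring⟩
  · exact ⟨-3 * a - 2, by simp, 2, by ring⟩
  · exact ⟨-a, by simp, 4, by ring⟩
  · exact ⟨a + 1, by simp, 1, by ring⟩

end Arithmetic

/-! ### Exponents of the roots and the cyclotomic cosets. -/

section Roots

variable {K : Type*} [Field K] {δ : K} {q n s J : ℕ} {a : ℤ}

/-- The root `δ ^ (s + r t)` of `x ^ n - α`. -/
def rootAt (δ : K) (q s : ℕ) (t : ℤ) : K := δ ^ ((s : ℤ) + (q + 1) * t)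

/-- The roots with exponents `s + r t`, `-J ≤ t ≤ J + 1`. -/
noncomputable def rootSet [DecidableEq K] (δ : K) (q s J : ℕ) : Finset K :=
  (Finset.Icc (-(J : ℤ)) (J + 1)).image (rootAt δ q s)

theorem mem_rootSet [DecidableEq K] {ρ : K} : ρ ∈ rootSet δ q s J ↔
    ∃ t : ℤ, (-(J : ℤ) ≤ t ∧ t ≤ J + 1) ∧ rootAt δ q s t = ρ := by
  simp [rootSet]

theorem zpow_eq_zpow_iff {N : ℕ} (hN : N ≠ 0) (hδ : IsPrimitiveRoot δ N) (x y : ℤ) :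
    δ ^ x = δ ^ y ↔ (N : ℤ) ∣ x - y := by
  have h0 : δ ≠ 0 := hδ.ne_zero hN
  rw [← hδ.zpow_eq_one_iff_dvd, zpow_sub₀ h0, div_eq_one_iff_eq (zpow_ne_zero _ h0)]

theorem pow_val_intCast {N : ℕ} (hN : N ≠ 0) (hδ : IsPrimitiveRoot δ N) (x : ℤ) :
    δ ^ (x : ZMod N).val = δ ^ x := by
  have : NeZero N := ⟨hN⟩
  rw [← zpow_natCast, zpow_eq_zpow_iff hN hδ, ZMod.val_intCast]
  exact ⟨-(x / N), by linear_combination Int.emod_add_mul_ediv x N⟩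

theorem pow_val_injective {N : ℕ} (hN : N ≠ 0) (hδ : IsPrimitiveRoot δ N) :
    Function.Injective fun i : ZMod N => δ ^ i.val := by
  have : NeZero N := ⟨hN⟩
  intro i j h
  exact ZMod.val_injective N (hδ.pow_inj (ZMod.val_lt i) (ZMod.val_lt j) h)

variable (hq : (q : ℤ) = 10 * a + 8) (hn : (n : ℤ) = 20 * a ^ 2 + 32 * a + 13)
  (hs : (s : ℤ) = (5 * a + 4) * (10 * a + 7)) (ha : 0 ≤ a)
  (hδ : IsPrimitiveRoot δ ((q + 1) * n))

include hn ha in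
theorem length_ne_zero : n ≠ 0 := by
  rintro rfl
  push_cast at hn
  nlinarith

include hn ha in
theorem order_ne_zero : (q + 1) * n ≠ 0 := mul_ne_zero (Nat.succ_ne_zero q) (length_ne_zero hn ha)

include hn ha hδ in
theorem rootAt_eq_iff (t t' : ℤ) : rootAt δ q s t = rootAt δ q s t' ↔ (n : ℤ) ∣ t - t' := by
  rw [rootAt, rootAt, zpow_eq_zpow_iff (order_ne_zero hn ha) hδ]
  push_cast
  rw [show (s : ℤ) + (q + 1) * t - (s + (q + 1) * t') = (q + 1) * (t - t') by ring]
  exact mul_dvd_mul_iff_left (by positivity)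

-- This rests on `q² + 1 = 5 n` and `s (q - 1) = 1 + 5 n (5a + 3)`.
include hq hn hs ha hδ in
theorem rootAt_frobenius (t : ℤ) : rootAt δ q s t ^ q ^ 2 = rootAt δ q s (1 - t) := by
  rw [rootAt, rootAt, ← zpow_natCast, ← zpow_mul, zpow_eq_zpow_iff (order_ne_zero hn ha) hδ]
  push_cast
  rw [hs, hq, hn]
  exact ⟨5 * (5 * a + 3) + 5 * t, by ring⟩

-- This rests on `s = 1 + r (5a + 3)`.
include hq hn hs ha hδ in
theorem rootAt_pow_length (t : ℤ) : rootAt δ q s t ^ n = δ ^ n := by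
  rw [rootAt, ← zpow_natCast, ← zpow_mul, ← zpow_natCast δ n,
    zpow_eq_zpow_iff (order_ne_zero hn ha) hδ]
  push_cast
  rw [hs, hq, hn]
  exact ⟨5 * a + 3 + t, by ring⟩

include hq hn hs ha hδ in
theorem conj_inv_rootAt_eq_iff (t t' : ℤ) : (rootAt δ q s t ^ q)⁻¹ = rootAt δ q s t' ↔
    20 * a ^ 2 + 32 * a + 13 ∣ (5 * a + 4) * (10 * a + 7) + (10 * a + 8) * t + t' := by
  rw [rootAt, rootAt, ← zpow_natCast, ← zpow_mul, ← zpow_neg,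
    zpow_eq_zpow_iff (order_ne_zero hn ha) hδ, ← dvd_neg]
  push_cast
  rw [hs, hq, hn]
  rw [show -(-(((5 * a + 4) * (10 * a + 7) + (10 * a + 8 + 1) * t) * (10 * a + 8)) -
    ((5 * a + 4) * (10 * a + 7) + (10 * a + 8 + 1) * t')) = (10 * a + 8 + 1) *
    ((5 * a + 4) * (10 * a + 7) + (10 * a + 8) * t + t') by ring]
  exact mul_dvd_mul_iff_left (by omega)

variable (hJ : (J : ℤ) ≤ 5 * a + 3) (hJ' : 3 * a + 2 ≤ (J : ℤ))

include hn ha hδ hJ in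
theorem rootAt_injOn : Set.InjOn (rootAt δ q s) (Finset.Icc (-(J : ℤ)) (J + 1)) := by
  intro t ht t' ht' h
  rw [Finset.coe_Icc, Set.mem_Icc] at ht ht'
  rw [rootAt_eq_iff hn ha hδ] at h
  refine sub_eq_zero.1 (Int.eq_zero_of_abs_lt_dvd h ?_)
  rw [abs_lt, hn]
  constructor <;> nlinarith

include hn ha hδ in
theorem exists_mem_exponentSet {ρ : K} (hρ : ρ ^ n = δ ^ n) :
    ∃ i ∈ exponentSet (q + 1) n, δ ^ i.val = ρ := by
  have hn0 := length_ne_zero hn ha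
  have hN := order_ne_zero (q := q) hn ha
  have : NeZero n := ⟨hn0⟩
  have hδ0 : δ ≠ 0 := hδ.ne_zero hN
  have hθ : IsPrimitiveRoot (δ ^ (q + 1)) n := hδ.pow (Nat.pos_of_ne_zero hN) rfl
  obtain ⟨j, hj, h⟩ := hθ.eq_pow_of_pow_eq_one (ξ := ρ * δ⁻¹) (by
    rw [mul_pow, hρ, inv_pow, mul_inv_cancel₀ (pow_ne_zero _ hδ0)])
  refine ⟨_, ⟨j, hj, rfl⟩, ?_⟩
  have h1 := pow_val_intCast hN hδ ((1 + (q + 1) * j : ℕ) : ℤ)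
  rw [Int.cast_natCast] at h1
  rw [h1, zpow_natCast, pow_add, pow_one, pow_mul, h, mul_comm, inv_mul_cancel_right₀ hδ0]

variable [DecidableEq K]

include hn ha hδ hJ in
theorem card_rootSet : (rootSet δ q s J).card = 2 * J + 2 := by
  rw [rootSet, Finset.card_image_of_injOn (rootAt_injOn hn ha hδ hJ), Int.card_Icc]
  omega

include hq hn hs ha hδ in
theorem rootSet_stable : ∀ ρ ∈ rootSet δ q s J, ρ ^ q ^ 2 ∈ rootSet δ q s J := by
  intro ρ hρ
  obtain ⟨t, ht, rfl⟩ := mem_rootSet.1 hρ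
  rw [rootAt_frobenius hq hn hs ha hδ]
  exact mem_rootSet.2 ⟨1 - t, by omega, rfl⟩

include hq hn hs ha hδ hJ hJ' in
theorem card_filter_rootSet :
    ({ρ ∈ rootSet δ q s J | (ρ ^ q)⁻¹ ∈ rootSet δ q s J} : Finset K).card = 4 := by
  -- The largest exponent `3a + 3` and the smallest `-3a - 2` fit because `J ≥ 3a + 2`, that is, `λ
  -- ≥ 1`.
  have hsub : ∀ t ∈ hullExponents a, -(J : ℤ) ≤ t ∧ t ≤ J + 1 := by
    intro t ht
    simp only [hullExponents, Finset.mem_insert, Finset.mem_singleton] at ht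
    omega
  have himg : ({ρ ∈ rootSet δ q s J | (ρ ^ q)⁻¹ ∈ rootSet δ q s J} : Finset K) =
      (hullExponents a).image (rootAt δ q s) := by
    ext ρ
    rw [Finset.mem_filter, Finset.mem_image, mem_rootSet, mem_rootSet]
    constructor
    · rintro ⟨⟨t, ht, rfl⟩, t', ht', h⟩
      rw [eq_comm, conj_inv_rootAt_eq_iff hq hn hs ha hδ] at h
      refine ⟨t, ?_, rfl⟩
      simp only [hullExponents, Finset.mem_insert, Finset.mem_singleton]
      exact mem_of_dvd_add ha (by omega) (by omega) h
    · rintro ⟨t, ht, rfl⟩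
      obtain ⟨t', ht', h⟩ := exists_dvd_add_of_mem ht
      exact ⟨⟨t, hsub t ht, rfl⟩, t', hsub t' ht',
        ((conj_inv_rootAt_eq_iff hq hn hs ha hδ t t').2 h).symm⟩
  rw [himg, Finset.card_image_of_injOn, card_hullExponents ha]
  refine (rootAt_injOn hn ha hδ hJ).mono fun t ht => ?_
  rw [Finset.coe_Icc, Set.mem_Icc]
  exact hsub t ht

include hq hn hs ha hδ in
theorem mem_cosetUnion_iff (i : ZMod ((q + 1) * n)) :
    i ∈ cosetUnion q (q + 1) n s J ↔ δ ^ i.val ∈ rootSet δ q s J := by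
  have hN := order_ne_zero (q := q) hn ha
  have hbase : ∀ (j m : ℕ), δ ^ (((s - (q + 1 : ℕ) * j : ℤ) : ZMod ((q + 1) * n)) *
      ((q ^ 2 : ℕ) : ZMod ((q + 1) * n)) ^ m).val = rootAt δ q s (-j) ^ (q ^ 2) ^ m := by
    intro j m
    have : ((s - (q + 1 : ℕ) * j : ℤ) : ZMod ((q + 1) * n)) *
        ((q ^ 2 : ℕ) : ZMod ((q + 1) * n)) ^ m =
        ((((s : ℤ) + (q + 1) * (-j)) * ((q ^ 2) ^ m : ℕ) : ℤ) : ZMod ((q + 1) * n)) := by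
      push_cast
      ring
    rw [this, pow_val_intCast hN hδ, rootAt, zpow_mul, zpow_natCast]
  simp only [cosetUnion, cyclotomicCoset, Set.mem_iUnion, Set.mem_ofPred_eq, Set.mem_Icc]
  constructor
  · rintro ⟨j, hj, m, rfl⟩
    rw [hbase]
    induction m with
    | zero =>
      rw [pow_zero, pow_one]
      exact mem_rootSet.2 ⟨-j, by omega, rfl⟩
    | succ m ih =>
      rw [pow_succ, pow_mul]
      exact rootSet_stable hq hn hs ha hδ _ ih
  · intro h
    obtain ⟨t, ht, h⟩ := mem_rootSet.1 h
    -- Exponents `t ≤ 0` are the representatives `s - r j` themselves; those with `t > 0` are their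
    -- images under one Frobenius step, with `j = t - 1`.
    rcases le_or_gt t 0 with h0 | h0
    · refine ⟨t.natAbs, by omega, 0, pow_val_injective hN hδ ?_⟩
      refine h.symm.trans (Eq.trans ?_ (hbase _ _).symm)
      rw [pow_zero, pow_one]
      congr 1
      omega
    · refine ⟨(t - 1).natAbs, by omega, 1, pow_val_injective hN hδ ?_⟩
      refine h.symm.trans (Eq.trans ?_ (hbase _ _).symm)
      rw [pow_one, rootAt_frobenius hq hn hs ha hδ]
      congr 1
      omega

end Roots

/-! ### Assembly: the classical code, its hull and the quantum code. -/

section Main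

open Polynomial

variable {F K : Type*} [Field F] [Field K] [Algebra F K] [DecidableEq K]
  {e n s J : ℕ} {a : ℤ} {α : F} {δ : K}

/-- The roots of `x ^ n - α`. -/
noncomputable def allRoots (n : ℕ) (α : F) (K : Type*) [Field K] [Algebra F K] [DecidableEq K] :
    Finset K :=
  (nthRoots n (algebraMap F K α)).toFinset

theorem mem_allRoots (hn0 : n ≠ 0) (ρ : K) : ρ ∈ allRoots n α K ↔ ρ ^ n = algebraMap F K α := by
  rw [allRoots, Multiset.mem_toFinset, mem_nthRoots (Nat.pos_of_ne_zero hn0)]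

theorem card_allRoots {θ : K} (hθ : IsPrimitiveRoot θ n) (hα : α ≠ 0)
    (hδα : δ ^ n = algebraMap F K α) : (allRoots n α K).card = n := by
  have hα' : algebraMap F K α ≠ 0 := by rwa [Ne, FaithfulSMul.algebraMap_eq_zero_iff]
  rw [allRoots, Multiset.toFinset_card_of_nodup (hθ.nthRoots_nodup hα'), hθ.card_nthRoots,
    if_pos ⟨δ, hδα⟩]

variable {q : ℕ} (hq : (q : ℤ) = 10 * a + 8) (hn : (n : ℤ) = 20 * a ^ 2 + 32 * a + 13)
  (hs : (s : ℤ) = (5 * a + 4) * (10 * a + 7)) (ha : 0 ≤ a) (hF : Nat.card F = q ^ 2)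
  (hδ : IsPrimitiveRoot δ ((q + 1) * n)) (hδα : δ ^ n = algebraMap F K α)

include hq hn hs ha hδ hδα in
theorem rootSet_subset : rootSet δ q s J ⊆ allRoots n α K := by
  intro ρ hρ
  obtain ⟨t, -, rfl⟩ := mem_rootSet.1 hρ
  rw [mem_allRoots (length_ne_zero hn ha), rootAt_pow_length hq hn hs ha hδ, hδα]

variable [Finite F]

include hq hn hs ha hF hδ hδα in
theorem exists_hasDefiningSet : ∃ C : Submodule F (Fin n → F), IsConstacyclic α C ∧
    HasDefiningSet α δ (q + 1) C (cosetUnion q (q + 1) n s J) := by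
  have hn0 := length_ne_zero hn ha
  have hN := order_ne_zero (q := q) hn ha
  have hY : ∀ ρ ∈ rootSet δ q s J, ρ ^ n = algebraMap F K α := fun ρ hρ =>
    (mem_allRoots hn0 ρ).1 (rootSet_subset hq hn hs ha hδ hδα hρ)
  have hYs : ∀ ρ ∈ rootSet δ q s J, ρ ^ Nat.card F ∈ rootSet δ q s J := by
    rw [hF]
    exact rootSet_stable hq hn hs ha hδ
  obtain ⟨g, hmonic, hg⟩ := exists_map_eq_prod (F := F) _ hYs
  refine ⟨rootCode F n (rootSet δ q s J), rootCode_isConstacyclic hY, g,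
    isGeneratorPoly_rootCode hg hmonic hY, ?_⟩
  ext i
  rw [mem_cosetUnion_iff hq hn hs ha hδ, Set.mem_ofPred_eq]
  have hroot : aeval (δ ^ i.val) g = 0 ↔ δ ^ i.val ∈ rootSet δ q s J := by
    rw [← eval_map_algebraMap, hg, eval_prod, Finset.prod_eq_zero_iff]
    constructor
    · rintro ⟨ρ, hρ, h⟩
      rw [eval_sub, eval_X, eval_C, sub_eq_zero] at h
      rwa [h]
    · exact fun h => ⟨_, h, by simp⟩
  rw [hroot]
  refine ⟨fun h => ⟨?_, h⟩, fun h => h.2⟩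
  obtain ⟨j, hj, h1⟩ := exists_mem_exponentSet hn ha hδ ((hY _ h).trans hδα.symm)
  rwa [← pow_val_injective hN hδ h1]

include hq hn hs ha hδ hδα in
theorem eq_rootCode_of_hasDefiningSet (hα : α ≠ 0) {C : Submodule F (Fin n → F)}
    (hC : HasDefiningSet α δ (q + 1) C (cosetUnion q (q + 1) n s J)) :
    C = rootCode F n (rootSet δ q s J) := by
  have hn0 := length_ne_zero hn ha
  have hN := order_ne_zero (q := q) hn ha
  have hθ : IsPrimitiveRoot (δ ^ (q + 1)) n := hδ.pow (Nat.pos_of_ne_zero hN) rfl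
  obtain ⟨g, hg, hZ⟩ := hC
  refine eq_rootCode_of_isGeneratorPoly hg (fun ρ => (mem_allRoots hn0 ρ).1)
    (card_allRoots hθ hα hδα) (rootSet_subset hq hn hs ha hδ hδα) fun ρ hρ => ?_
  rw [mem_allRoots hn0, ← hδα] at hρ
  obtain ⟨i, hi, rfl⟩ := exists_mem_exponentSet hn ha hδ hρ
  rw [← mem_cosetUnion_iff hq hn hs ha hδ, hZ]
  exact ⟨fun h => ⟨hi, h⟩, fun h => h.2⟩

/-- The properties of the constacyclic code with the given defining set. -/
theorem rootCode_properties [DecidableEq F] (hq2 : q = 2 ^ e) (hq : (q : ℤ) = 10 * a + 8)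
    (hn : (n : ℤ) = 20 * a ^ 2 + 32 * a + 13) (hs : (s : ℤ) = (5 * a + 4) * (10 * a + 7))
    (ha : 0 ≤ a) (hJ : (J : ℤ) ≤ 5 * a + 3) (hJ' : 3 * a + 2 ≤ (J : ℤ)) (hF : Nat.card F = q ^ 2)
    (hα : α ^ (q + 1) = 1) (hδ : IsPrimitiveRoot δ ((q + 1) * n)) (hδα : δ ^ n = algebraMap F K α)
    {C : Submodule F (Fin n → F)} (hC : C = rootCode F n (rootSet δ q s J)) :
    Module.finrank F C + (2 * J + 2) = n ∧ IsMinWeight C (2 * J + 3) ∧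
    (∀ (m : ℕ) (H : Matrix (Fin m) (Fin n) F), IsParityCheck C H →
      (H * hermTranspose q H).rank = 4) ∧ ExistsEAQEC q n (n - 4 * J) (2 * J + 3) 4 := by
  have hn0 := length_ne_zero hn ha
  have hN := order_ne_zero (q := q) hn ha
  have hα0 : α ≠ 0 := by
    rintro rfl
    rw [zero_pow (Nat.succ_ne_zero q)] at hα
    exact zero_ne_one hα
  have hθ : IsPrimitiveRoot (δ ^ (q + 1)) n := hδ.pow (Nat.pos_of_ne_zero hN) rfl
  set Ω := allRoots n α K with hΩdef
  set Y := rootSet δ q s J with hYdef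
  have hΩ : ∀ ρ, ρ ∈ Ω ↔ ρ ^ n = algebraMap F K α := mem_allRoots hn0
  have hΩcard : Ω.card = n := card_allRoots hθ hα0 hδα
  have hYΩ : Y ⊆ Ω := rootSet_subset hq hn hs ha hδ hδα
  have hYcard : Y.card = 2 * J + 2 := card_rootSet hn ha hδ hJ
  have hYs : ∀ ρ ∈ Y, ρ ^ Nat.card F ∈ Y := by
    rw [hF]
    exact rootSet_stable hq hn hs ha hδ
  have hhull : ({ρ ∈ Y | (ρ ^ q)⁻¹ ∈ Y} : Finset K).card = 4 :=
    card_filter_rootSet hq hn hs ha hδ hJ hJ'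
  have hodd : Odd n := by
    have : Odd (n : ℤ) := ⟨10 * a ^ 2 + 16 * a + 6, by rw [hn]; ring⟩
    exact_mod_cast this
  -- This makes `k = n - 4J` positive, so the natural subtraction is harmless and `C ≤ D`, which
  -- would force `n = 4J`, is excluded.
  have hlen : 4 * J + 1 ≤ n := by
    zify
    nlinarith
  subst hq2
  set D := rootCode F n (dualRoots (2 ^ e) Ω Y) with hD
  have hCrank : Module.finrank F C + (2 * J + 2) = n := by
    rw [hC, ← hYcard]
    exact finrank_rootCode Y hYs (by rw [← hΩcard]; exact Finset.card_le_card hYΩ)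
  have hDrank : Module.finrank F D = 2 * J + 2 := by
    rw [← hYcard]
    exact finrank_rootCode_dualRoots hF hΩ hα hΩcard hYΩ hYs
  have hCDrank : Module.finrank F (C ⊓ D : Submodule F (Fin n → F)) + 4 = 2 * J + 2 := by
    rw [← hYcard, ← hhull, hC]
    exact finrank_rootCode_inf_dualRoots hF hΩ hα hΩcard hYΩ hYs
  have horth : ∀ c ∈ C, ∀ d ∈ D, ∑ i, c i * d i ^ 2 ^ e = 0 := by
    intro c hc d hd
    rw [hC] at hc
    exact hermitian_orthogonal_dualRoots hF hΩ hα0 hΩcard hodd hθ hc hd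
  have hmin : ∀ c ∈ C, c ≠ 0 → 2 * J + 2 < hammingNorm c := by
    intro c hc hc0
    rw [hC] at hc
    have hγ : rootAt δ (2 ^ e) s (-J) ≠ 0 := zpow_ne_zero _ (hδ.ne_zero hN)
    refine lt_hammingNorm_of_roots hθ hγ hc0 fun u hu => hc _ (mem_rootSet.2 ⟨-J + u, by omega, ?_⟩)
    rw [rootAt, rootAt, ← pow_mul, ← zpow_natCast, ← zpow_add₀ (hδ.ne_zero hN)]
    congr 1
    push_cast
    ring
  have hdim : Module.finrank F C + Module.finrank F D = n := by rw [hDrank, hCrank]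
  have hCD : ¬ C ≤ D := by
    intro h
    rw [inf_eq_left.2 h] at hCDrank
    omega
  obtain ⟨c, hc, hcD, hcw⟩ := exists_min_weight_not_mem hCrank hmin hCD
  refine ⟨hCrank, ⟨⟨c, hc, fun h => hcD (h ▸ D.zero_mem), hcw⟩, ?_⟩, fun m H hH => ?_, ?_⟩
  · rintro w ⟨c, hc, hc0, rfl⟩
    exact hmin c hc hc0
  · have := rank_mul_hermTranspose hF hdim horth hH
    omega
  · exact existsEAQEC_of_hermitian hF hdim horth (by omega) (by omega) hmin ⟨c, hc, hcD, hcw⟩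

end Main

end EAQ

theorem mainTheorem6 (e q n lam : ℕ) (hq : q = 2 ^ e) (hq8 : q ≡ 8 [MOD 10])
    (hn : 5 * n = q ^ 2 + 1) (hlam : 1 ≤ lam) (hlam' : 5 * lam ≤ q + 2)
    {F : Type*} [Field F] [DecidableEq F] (hF : Nat.card F = q ^ 2)
    {K : Type*} [Field K] [Algebra F K]
    (α : F) (hα : IsPrimitiveRoot α (q + 1))
    (δ : K) (hδ : IsPrimitiveRoot δ ((q + 1) * n)) (hδα : δ ^ n = algebraMap F K α)
    (s J : ℕ) (hs : 2 * s = q ^ 2 - q) (hJ : 10 * J + 14 = 3 * q + 10 * lam) :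
    (∃ C : Submodule F (Fin n → F), EAQ.IsConstacyclic α C ∧
      EAQ.HasDefiningSet α δ (q + 1) C (EAQ.cosetUnion q (q + 1) n s J)) ∧
    ∀ C : Submodule F (Fin n → F), EAQ.IsConstacyclic α C →
      EAQ.HasDefiningSet α δ (q + 1) C (EAQ.cosetUnion q (q + 1) n s J) →
      ∃ k d : ℕ,
        (k : ℚ) = n - 2 / 5 * (3 * q - 14) - 4 * lam ∧
        (d : ℚ) = (3 * q - 14) / 5 + 2 * lam + 3 ∧
        -- the parameters are those that the Hermitian construction assigns to `C`
        (k : ℤ) = 2 * (Module.finrank F C : ℤ) - n + 4 ∧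
        EAQ.IsMinWeight C d ∧
        (∀ (m : ℕ) (H : Matrix (Fin m) (Fin n) F), EAQ.IsParityCheck C H →
          (H * EAQ.hermTranspose q H).rank = 4) ∧
        -- the quantum code exists and attains the entanglement-assisted Singleton bound
        EAQ.ExistsEAQEC q n k d 4 ∧
        (n : ℤ) + 4 - k = 2 * ((d : ℤ) - 1) ∧
        (¬ (q = 8 ∧ lam = 2) → (d : ℚ) ≤ (n + 2) / 2) := by
  classical
  have : Finite F := Nat.finite_of_card_ne_zero (by rw [hF, hq]; positivity)
  obtain ⟨b, hb⟩ : ∃ b : ℕ, q = 10 * b + 8 := ⟨q / 10, by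
    have : q % 10 = 8 := hq8
    omega⟩
  have hqz : (q : ℤ) = 10 * (b : ℤ) + 8 := by exact_mod_cast hb
  have hnz : (n : ℤ) = 20 * (b : ℤ) ^ 2 + 32 * b + 13 := by
    have : 5 * (n : ℤ) = q ^ 2 + 1 := by exact_mod_cast hn
    rw [hqz] at this
    linarith
  have hsz : (s : ℤ) = (5 * (b : ℤ) + 4) * (10 * b + 7) := by
    have hle : q ≤ q ^ 2 := Nat.le_self_pow two_ne_zero q
    have : 2 * (s : ℤ) = q ^ 2 - q := by
      have h1 := congrArg (Nat.cast : ℕ → ℤ) hs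
      rw [Nat.cast_sub hle] at h1
      exact_mod_cast h1
    rw [hqz] at this
    linarith
  have hb0 : (0 : ℤ) ≤ b := Int.natCast_nonneg b
  -- Here `J = 3b + 1 + λ` with `1 ≤ λ ≤ 2b + 2`.
  have hJle : (J : ℤ) ≤ 5 * b + 3 := by omega
  have hJge : 3 * (b : ℤ) + 2 ≤ J := by omega
  have hα0 : α ≠ 0 := hα.ne_zero (Nat.succ_ne_zero q)
  refine ⟨EAQ.exists_hasDefiningSet hqz hnz hsz hb0 hF hδ hδα, fun C _ hC => ?_⟩
  obtain ⟨hrank, hmin, hH, hQ⟩ := EAQ.rootCode_properties hq hqz hnz hsz hb0 hJle hJge hF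
    hα.pow_eq_one hδ hδα (EAQ.eq_rootCode_of_hasDefiningSet hqz hnz hsz hb0 hδ hδα hα0 hC)
  have hlen : 4 * J + 1 ≤ n := by
    zify
    nlinarith
  have hJq : 10 * (J : ℚ) + 14 = 3 * q + 10 * lam := by exact_mod_cast hJ
  have hk : ((n - 4 * J : ℕ) : ℚ) = n - 4 * J := by
    rw [Nat.cast_sub (by omega)]
    push_cast
    ring
  refine ⟨n - 4 * J, 2 * J + 3, ?_, ?_, by omega, hmin, hH, hQ, by omega, fun hne => ?_⟩
  · rw [hk]
    linarith
  · push_cast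
    linarith
  -- The bound `d ≤ (n + 2)/2` amounts to `4J + 4 ≤ n`. It can fail only for `b = 0`, where `n = 13`
  -- and `J = 1 + λ`, and there only for `λ = 2`.
  · have h1 : 4 * J + 4 ≤ n := by
      rcases Nat.eq_zero_or_pos b with rfl | hbpos
      · have : lam = 1 := by omega
        omega
      · zify
        have : (1 : ℤ) ≤ b := by exact_mod_cast hbpos
        nlinarith
    have h2 : 4 * (J : ℚ) + 4 ≤ n := by exact_mod_cast h1
    push_cast
    linarith
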